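/- Let $N,d\ge 1$ be integers and let $E=Mat^h_{N,2d}$ be the real Hilbert space of $2d$-tuples $(A,B)=(A_1,\dots,A_d,B_1,\dots,B_d)$ of Hermitian $N\times N$ matrices with inner product $((A,B),(F,G))=\sum_{\mu}\mathrm{Tr}(A_\mu F_\mu+B_\mu G_\mu)$. Let $\mu_{N,d}$ be the standard Gaussian measure on $E$, i.e. the one with characteristic function $\exp(-\tfrac12|\cdot|^2)$. Every $f\in L^2(\mu_{N,d})$ (complex valued) has a chaos decomposition $f=\sum_n I_n f$, where $I_n$ is the orthogonal projection of $L^2(\mu_{N,d})$ onto the polynomials of degree at most $n$ that are orthogonal to all polynomials of smaller degree. The space $(E)$ of Hida test functions consists of all $f\in L^2(\mu_{N,d})$ for which $\|f\|_q^2=\sum_n 2^{2qn}\|I_nf\|_{L^2}^2<\infty$ for every $q\in\mathbb N_0$, with the topology given by these norms; its topological dual $(E)'$ is the space of Hida distributions. For $\epsilon>0$ let $$\Phi_{N,d,\epsilon}(x)=2^{dN}\pi^{dN^2}\exp\Big(-\tfrac12 (x,K_\epsilon x)\Big),\quad x=(A,B)\in E,\qquad K_\epsilon=-\Big((1-\epsilon)\,\mathrm{Id}+i\begin{pmatrix}0&\mathrm{Id}\\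 \mathrm{Id}&0\end{pmatrix}\Big),$$ where $(\cdot,\cdot)$ is extended complex bilinearly. Then for every $\epsilon>0$ the function $\Phi_{N,d,\epsilon}$ is in $L^1(\mu_{N,d})$ (for $\epsilon\le\frac12$ it is not in $L^2(\mu_{N,d})$), and it is a Hida distribution: for every $\varphi\in(E)$ the function $\Phi_{N,d,\epsilon}\varphi$ is $\mu_{N,d}$-integrable, and $\varphi\mapsto\int_E\Phi_{N,d,\epsilon}\,\varphi\,d\mu_{N,d}$ is a continuous linear functional on $(E)$. For all $(F,G)\in E$ the function $\exp(i(\cdot,(F,G)))$ belongs to $(E)$, and the $T$-transform of $\Phi_{N,d,\epsilon}$, i.e. the pairing of $\Phi_{N,d,\epsilon}$ with it, is $$T\Phi_{N,d,\epsilon}(F,G)=2^{dN}\Big(\frac{\pi}{\sqrt{\epsilon^2+1}}\Big)^{dN^2}\exp\Big(-\frac{\epsilon\sum_\mu\mathrm{Tr}(F_\mu F_\mu+G_\mu G_\mu)+2i\sum_\mu\mathrm{Tr}(F_\mu G_\mu)}{2(\epsilon^2+1)}\Big).$$ This is a $U$-functional. Here $U:E\to\mathbb C$ is called a $U$-functional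 if for all $X,Y\in E$ the map $\mathbb R\ni l\mapsto U(Y+lX)$ has an entire extension to $l\in\mathbb C$, and there are constants $K,C>0$ and a continuous quadratic form $Q$ on $E$ such that $|U(zX)|\le K\exp(C|z|^2Q(X))$ for all $X\in E$, $z\in\mathbb C$, where $U(zX)$ denotes the value at $z$ of the entire extension of $l\mapsto U(lX)$. -/

import Mathlib

open MeasureTheory ProbabilityTheory
open scoped ENNReal

noncomputable section

/-! ### Hida test functions and Hida distributions over a finite dimensional Euclidean space

Here the nuclear triple is `E = E = E`, and `stdGaussian E` is the standard Gaussian measure on `E`,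
i.e. the one with characteristic function `exp (-‖F‖² / 2)`. -/

section Hida

variable (E : Type*) [NormedAddCommGroup E] [InnerProductSpace ℝ E] [FiniteDimensional ℝ E]
  [MeasurableSpace E] [BorelSpace E]

/-- The complex space `L²(μ)`, with `μ` the standard Gaussian measure. -/
abbrev GaussL2 : Type _ := Lp ℂ 2 (stdGaussian E)

/-- The (closed) space of complex polynomials of degree at most `n`, as a subspace of `L²(μ)`: it is
spanned by the products of at most `n` linear functionals `⟨F i, ·⟩`. -/
def polyLE (n : ℕ) : Submodule ℂ (GaussL2 E) :=
  (Submodule.span ℂ {f : GaussL2 E | ∃ m : ℕ, m ≤ n ∧ ∃ F : Fin m → E,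
    (f : E → ℂ) =ᵐ[stdGaussian E] fun x => ∏ i, ((inner ℝ (F i) x : ℝ) : ℂ)}).topologicalClosure

/-- The `n`-th Wiener chaos, i.e. the space of all Wick monomials `⟨:A^⊗n:, f⁽ⁿ⁾⟩`:
the polynomials of degree at most `n` that are orthogonal to all those of smaller degree. -/
def chaos : ℕ → Submodule ℂ (GaussL2 E)
  | 0 => polyLE E 0
  | n + 1 => polyLE E (n + 1) ⊓ (polyLE E n)ᗮ

theorem isClosed_chaos (n : ℕ) : IsClosed (chaos E n : Set (GaussL2 E)) := by
  cases n with
  | zero => exact Submodule.isClosed_topologicalClosure _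
  | succ n =>
    exact (Submodule.isClosed_topologicalClosure _).inter (Submodule.isClosed_orthogonal _)

instance instHasOrthogonalProjectionChaos (n : ℕ) : (chaos E n).HasOrthogonalProjection :=
  haveI : CompleteSpace (chaos E n) := (isClosed_chaos E n).completeSpace_coe
  inferInstance

/-- The `n`-th term `⟨:A^⊗n:, f⁽ⁿ⁾⟩` of the chaos decomposition of `f ∈ L²(μ)`. Its `L²`-norm
squared is `n! |f⁽ⁿ⁾|²`. -/
def chaosProj (n : ℕ) : GaussL2 E →L[ℂ] GaussL2 E := (chaos E n).starProjection

/-- The sequence `(2 ^ (q n) ⟨:A^⊗n:, f⁽ⁿ⁾⟩)ₙ`. -/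
def chaosSeq (q : ℕ) : GaussL2 E →ₗ[ℂ] PreLp (fun _ : ℕ => GaussL2 E) where
  toFun f := fun n => ((2 : ℂ) ^ (q * n)) • chaosProj E n f
  map_add' f g := by
    funext n
    simp only [map_add, smul_add]
    rfl
  map_smul' c f := by
    funext n
    simp only [map_smul, RingHom.id_apply]
    exact smul_comm _ _ _

/-- The Hida test functions: those `f ∈ L²(μ)` for which all the norms
`‖f‖_q² = ∑ₙ n! (2 ^ (q n) |f⁽ⁿ⁾|)²`, `q = 0, 1, 2, …`, are finite. This is the projective limit
of the Fock spaces over `(E, 2 ^ q ‖·‖)`, and these norms dominate every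
Hilbert norm on `E`. -/
def hidaTestSubmodule : Submodule ℂ (GaussL2 E) where
  carrier := {f | ∀ q : ℕ, Memℓp (chaosSeq E q f) 2}
  zero_mem' q := by
    rw [map_zero]
    exact zero_memℓp
  add_mem' {f g} hf hg q := by
    rw [map_add]
    exact (hf q).add (hg q)
  smul_mem' c f hf q := by
    rw [map_smul]
    exact (hf q).const_smul c

/-- The space of Hida test functions. It is a type of its own because it carries
the projective limit topology, and not the one inherited from `L²(μ)`. -/
def HidaTest : Type _ := hidaTestSubmodule E

instance : AddCommGroup (HidaTest E) := inferInstanceAs (AddCommGroup (hidaTestSubmodule E))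

instance : Module ℂ (HidaTest E) := inferInstanceAs (Module ℂ (hidaTestSubmodule E))

/-- The inclusion of the Hida test functions into `L²(μ)`. -/
def HidaTest.toL2 : HidaTest E →ₗ[ℂ] GaussL2 E := (hidaTestSubmodule E).subtype

/-- `f ↦ (2 ^ (q n) ⟨:A^⊗n:, f⁽ⁿ⁾⟩)ₙ`, as a map into square summable sequences. -/
def HidaTest.toEll2 (q : ℕ) : HidaTest E →ₗ[ℂ] lp (fun _ : ℕ => GaussL2 E) 2 where
  toFun f := ⟨chaosSeq E q (HidaTest.toL2 E f), f.2 q⟩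
  map_add' f g := Subtype.ext (by simp only [map_add]; rfl)
  map_smul' c f := Subtype.ext (by simp only [map_smul]; rfl)

/-- The norm `‖f‖_q = (∑ₙ n! (2 ^ (q n) |f⁽ⁿ⁾|)²) ^ (1/2)`. -/
def HidaTest.seminorm : SeminormFamily ℂ (HidaTest E) ℕ := fun q =>
  (normSeminorm ℂ (lp (fun _ : ℕ => GaussL2 E) 2)).comp (HidaTest.toEll2 E q)

/-- The projective limit topology: the locally convex topology given by the norms `‖·‖_q`. -/
instance : TopologicalSpace (HidaTest E) := (HidaTest.seminorm E).moduleFilterBasis.topology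

/-- The Hida distributions: the topological dual of the space of Hida test functions. -/
abbrev HidaDistribution : Type _ := HidaTest E →L[ℂ] ℂ

variable {E}

/-- The Hida distribution `Ψ` is (given by) the function `f`: the bilinear dual pairing of `Ψ` with a
test function `φ` is `∫ f φ dμ`, where this integral converges absolutely. -/
def HidaDistribution.IsGivenBy (Ψ : HidaDistribution E) (f : E → ℂ) : Prop :=
  ∀ φ : HidaTest E, Integrable (fun x => f x * HidaTest.toL2 E φ x) (stdGaussian E) ∧
    Ψ φ = ∫ x, f x * HidaTest.toL2 E φ x ∂(stdGaussian E)

/-- `U` is the `T`-transform of `Ψ`: for each `F`, the function `exp (i ⟨·, F⟩)` is (the class of) a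
Hida test function and its pairing with `Ψ` is `U F`. -/
def HidaDistribution.HasTTransform (Ψ : HidaDistribution E) (U : E → ℂ) : Prop :=
  ∀ F : E, ∃ e : HidaTest E,
    (HidaTest.toL2 E e : E → ℂ) =ᵐ[stdGaussian E]
        (fun x => Complex.exp (Complex.I * ((inner ℝ x F : ℝ) : ℂ))) ∧
      Ψ e = U F

/-- `U`-functionals: (i) `U` is ray entire; (ii) the entire extension `z ↦ U (z F)` is bounded by
`K exp (C |z|² Q F)` with a continuous quadratic form `Q`. -/
structure IsUFunctional (U : E → ℂ) : Prop where
  entire : ∀ F G : E, ∃ h : ℂ → ℂ, Differentiable ℂ h ∧ ∀ l : ℝ, h l = U (G + l • F)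
  bound : ∃ K C : ℝ, 0 < K ∧ 0 < C ∧ ∃ Q : QuadraticForm ℝ E, Continuous Q ∧
    ∀ F : E, ∃ h : ℂ → ℂ, Differentiable ℂ h ∧ (∀ l : ℝ, h l = U (l • F)) ∧
      ∀ z : ℂ, ‖h z‖ ≤ K * Real.exp (C * ‖z‖ ^ 2 * Q F)

end Hida

/-! ### Spaces of Hermitian matrices -/

/-- The real vector space of Hermitian `N × N` matrices. -/
def HermMat (N : ℕ) : Type := selfAdjoint.submodule ℝ (Matrix (Fin N) (Fin N) ℂ)

namespace HermMat

variable {N : ℕ}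

instance : AddCommGroup (HermMat N) :=
  inferInstanceAs (AddCommGroup (selfAdjoint.submodule ℝ (Matrix (Fin N) (Fin N) ℂ)))

instance : Module ℝ (HermMat N) :=
  inferInstanceAs (Module ℝ (selfAdjoint.submodule ℝ (Matrix (Fin N) (Fin N) ℂ)))

instance : FiniteDimensional ℝ (HermMat N) :=
  inferInstanceAs (FiniteDimensional ℝ (selfAdjoint.submodule ℝ (Matrix (Fin N) (Fin N) ℂ)))

/-- The underlying matrix. -/
def toMatrix : HermMat N →ₗ[ℝ] Matrix (Fin N) (Fin N) ℂ :=
  (selfAdjoint.submodule ℝ (Matrix (Fin N) (Fin N) ℂ)).subtype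

theorem conjTranspose_toMatrix (A : HermMat N) : (toMatrix A).conjTranspose = toMatrix A := A.2

theorem re_trace_mul_self (A : HermMat N) :
    ((toMatrix A * toMatrix A).trace).re = ∑ i, ∑ j, ‖toMatrix A i j‖ ^ 2 := by
  have h : (toMatrix A * toMatrix A).trace
      = ((toMatrix A).conjTranspose * toMatrix A).trace := by rw [conjTranspose_toMatrix]
  rw [h, Matrix.trace, Complex.re_sum, Finset.sum_comm]
  refine Finset.sum_congr rfl fun i _ => ?_
  rw [Matrix.diag_apply, Matrix.mul_apply, Complex.re_sum]
  refine Finset.sum_congr rfl fun j _ => ?_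
  rw [Matrix.conjTranspose_apply, Complex.sq_norm, Complex.normSq_apply]
  simp

/-- The inner product `(A, B) = Tr (B A)`, which is real on Hermitian matrices. -/
instance instCore : InnerProductSpace.Core ℝ (HermMat N) where
  inner A B := ((toMatrix B * toMatrix A).trace).re
  conj_inner_symm A B := by
    simp only [conj_trivial]
    rw [Matrix.trace_mul_comm]
  re_inner_nonneg A := by
    simp only [RCLike.re_to_real]
    rw [re_trace_mul_self]
    positivity
  add_left A B C := by simp [mul_add]
  smul_left A B r := by simp
  definite A h := by
    rw [re_trace_mul_self] at h
    apply Subtype.ext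
    ext i j
    have h1 := (Finset.sum_eq_zero_iff_of_nonneg (fun i _ => by positivity)).1 h i
      (Finset.mem_univ i)
    have h2 := (Finset.sum_eq_zero_iff_of_nonneg (fun j _ => by positivity)).1 h1 j
      (Finset.mem_univ j)
    exact norm_eq_zero.1 (pow_eq_zero_iff two_ne_zero |>.1 h2)

instance : NormedAddCommGroup (HermMat N) :=
  InnerProductSpace.Core.toNormedAddCommGroup (𝕜 := ℝ)

instance : InnerProductSpace ℝ (HermMat N) := InnerProductSpace.ofCore instCore.toCore

theorem inner_def (A B : HermMat N) :
    inner ℝ A B = ((toMatrix B * toMatrix A).trace).re := rfl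

instance : MeasurableSpace (HermMat N) := borel _

instance : BorelSpace (HermMat N) := ⟨rfl⟩

end HermMat

/-- The real Hilbert space of `2d`-tuples of Hermitian `N × N` matrices, with the trace inner
product. The components indexed by `Sum.inl μ` are the `A_μ`, those indexed by `Sum.inr μ`
are the `B_μ`. -/
abbrev PhaseSpace (N d : ℕ) : Type := PiLp 2 (fun _ : Fin d ⊕ Fin d => HermMat N)

/-- The complexification of `PhaseSpace N d`: `2d`-tuples of complex matrices. -/
abbrev PhaseSpaceC (N d : ℕ) : Type := Fin d ⊕ Fin d → Matrix (Fin N) (Fin N) ℂ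

/-- The inclusion of `PhaseSpace N d` into its complexification. -/
def PhaseSpace.toC {N d : ℕ} (x : PhaseSpace N d) : PhaseSpaceC N d := fun k => (x k).toMatrix

/-- The complex bilinear extension of the trace inner product. -/
def traceForm {N d : ℕ} (X Y : PhaseSpaceC N d) : ℂ := ∑ k, (X k * Y k).trace

/-- The operator `K_ε = -((1 - ε) Id + i (0 Id; Id 0))`. -/
def symplecticK (N d : ℕ) (ε : ℝ) (X : PhaseSpaceC N d) : PhaseSpaceC N d :=
  fun k => -(((1 - ε : ℝ) : ℂ) • X k + Complex.I • X k.swap)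

/-- The regularized symplectic Feynman distribution
`Φ_{N,d,ε} = 2^{dN} π^{dN²} exp (-1/2 (x, K_ε x))`, `x = (A, B)`. -/
def feynmanPhi (N d : ℕ) (ε : ℝ) (x : PhaseSpace N d) : ℂ :=
  2 ^ (d * N) * (Real.pi : ℂ) ^ (d * N ^ 2) *
    Complex.exp (-(1 / 2) * traceForm x.toC (symplecticK N d ε x.toC))

/-- The Gaussian
`2^{dN} (π / √(ε² + 1))^{dN²} exp (-(ε Tr(F_μ F_μ + G_μ G_μ) + 2 i Tr(F_μ G_μ)) / (2 (ε² + 1)))`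
in `y = (F, G)`, with summation over `μ`. -/
def feynmanT (N d : ℕ) (ε : ℝ) (y : PhaseSpace N d) : ℂ :=
  2 ^ (d * N) * ((Real.pi / Real.sqrt (ε ^ 2 + 1) : ℝ) : ℂ) ^ (d * N ^ 2) *
    Complex.exp (-((ε : ℂ) *
        (∑ μ : Fin d, (y.toC (.inl μ) * y.toC (.inl μ) + y.toC (.inr μ) * y.toC (.inr μ)).trace) +
        2 * Complex.I * ∑ μ : Fin d, (y.toC (.inl μ) * y.toC (.inr μ)).trace) /
      (2 * ((ε : ℂ) ^ 2 + 1)))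

end

/-! Let D be the dimension of the phase space and T the exchange (A, B) ↦ (B, A). Since T is real,
|Φ| is a constant times exp((1 - ε)|x|²/2); after multiplication by the Gaussian density this decays
like exp(-ε|x|²/2). So Φ is integrable, while |Φ|² times the density is bounded below when ε ≤ 1/2.

The real work is continuity on (E), which follows from a bound ∫ |φ| exp((1 - ε)|x|²/2) dμ ≤ C
‖φ‖_q. For a polynomial p of degree at most n, the function t ↦ t^(D(1+2n)) ∫ p² exp(-t|x|²/2) is
nondecreasing (`PolyDeg.gaussInt_sq_le`), so for ε ≤ 1 widening the Gaussian costs only a factor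
geometric in n. Cauchy-Schwarz turns this into K Bⁿ ‖p‖ (`exists_weightedL1_span_le`). As ‖I_n φ‖ ≤
2^(-qn) ‖φ‖_q, a q with 2^q > 2B makes the sum over chaoses converge, and Fatou's lemma transfers
the bound to φ (`exists_weightedL1_hidaTest_le`). The monotonicity rests on a Gaussian
Bernstein-Markov inequality; the convergence of the chaos expansion rests on density of polynomials,
deduced from injectivity of the Fourier transform.

The exponentials lie in (E) because their Taylor remainders decay in L² faster than any geometric
sequence. Their pairing with Φ is a Gaussian integral with matrix ε - iT. As T is a symmetric
involution of trace zero, its eigenvalues are ±1 and sum to zero: the phases of the square roots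
cancel, leaving the power of √(ε² + 1), and (ε - iT)⁻¹ = (ε + iT)/(ε² + 1) gives the exponent. The
result is a constant times the exponential of a quadratic form, hence a U-functional. -/

noncomputable section

set_option linter.unusedSectionVars false

/-! ### Polynomials, Gaussian weights and integration by parts. -/

section GaussianWeight

variable {E : Type*} [NormedAddCommGroup E] [InnerProductSpace ℝ E]

/-- Real polynomial functions of degree at most `n` on an inner product space. -/
inductive PolyDeg : ℕ → (E → ℝ) → Prop
  | const (n : ℕ) (c : ℝ) : PolyDeg n (fun _ => c)
  | add {n : ℕ} {f g : E → ℝ} : PolyDeg n f → PolyDeg n g → PolyDeg n (fun x => f x + g x)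
  | mul_inner {n : ℕ} {f : E → ℝ} (v : E) :
      PolyDeg n f → PolyDeg (n + 1) (fun x => inner ℝ v x * f x)

/-- Continuous functions of at most polynomial growth. -/
def PolyGrowth (f : E → ℝ) : Prop :=
  Continuous f ∧ ∃ C : ℝ, ∃ k : ℕ, 0 ≤ C ∧ ∀ x, |f x| ≤ C * (1 + ‖x‖) ^ k

namespace PolyGrowth

theorem const (c : ℝ) : PolyGrowth (fun _ : E => c) :=
  ⟨continuous_const, |c|, 0, abs_nonneg c, fun x => by simp⟩

theorem inner (v : E) : PolyGrowth (fun x : E => inner ℝ v x) := by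
  refine ⟨by fun_prop, ‖v‖, 1, norm_nonneg v, fun x => ?_⟩
  refine (abs_real_inner_le_norm v x).trans ?_
  rw [pow_one]
  exact mul_le_mul_of_nonneg_left (by linarith) (norm_nonneg v)

theorem norm_sq : PolyGrowth (fun x : E => ‖x‖ ^ 2) := by
  refine ⟨by fun_prop, 1, 2, zero_le_one, fun x => ?_⟩
  rw [abs_of_nonneg (by positivity), one_mul]
  exact pow_le_pow_left₀ (norm_nonneg x) (by linarith) 2

theorem add {f g : E → ℝ} (hf : PolyGrowth f) (hg : PolyGrowth g) :
    PolyGrowth (fun x => f x + g x) := by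
  obtain ⟨hfc, C, k, hC, hf⟩ := hf
  obtain ⟨hgc, C', k', hC', hg⟩ := hg
  refine ⟨hfc.add hgc, C + C', k + k', by positivity, fun x => ?_⟩
  have h1 : (1 : ℝ) ≤ 1 + ‖x‖ := by linarith [norm_nonneg x]
  calc |f x + g x| ≤ |f x| + |g x| := abs_add_le _ _
    _ ≤ C * (1 + ‖x‖) ^ k + C' * (1 + ‖x‖) ^ k' := add_le_add (hf x) (hg x)
    _ ≤ C * (1 + ‖x‖) ^ (k + k') + C' * (1 + ‖x‖) ^ (k + k') := by
        gcongr <;> first | exact h1 | omega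
    _ = _ := by ring

theorem mul {f g : E → ℝ} (hf : PolyGrowth f) (hg : PolyGrowth g) :
    PolyGrowth (fun x => f x * g x) := by
  obtain ⟨hfc, C, k, hC, hf⟩ := hf
  obtain ⟨hgc, C', k', hC', hg⟩ := hg
  refine ⟨hfc.mul hgc, C * C', k + k', by positivity, fun x => ?_⟩
  calc |f x * g x| = |f x| * |g x| := abs_mul _ _
    _ ≤ (C * (1 + ‖x‖) ^ k) * (C' * (1 + ‖x‖) ^ k') := by
        gcongr
        · exact hf x
        · exact hg x
    _ = _ := by ring

theorem const_mul {f : E → ℝ} (hf : PolyGrowth f) (c : ℝ) : PolyGrowth (fun x => c * f x) :=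
  (const c).mul hf

theorem sub {f g : E → ℝ} (hf : PolyGrowth f) (hg : PolyGrowth g) :
    PolyGrowth (fun x => f x - g x) := by
  convert hf.add (hg.const_mul (-1)) using 2
  ring

theorem sq {f : E → ℝ} (hf : PolyGrowth f) : PolyGrowth (fun x => f x ^ 2) := by
  simpa only [pow_two] using hf.mul hf

end PolyGrowth

/-- The Gaussian weight `exp (-l ‖x‖² / 2)`. -/
def gaussWeight (l : ℝ) (x : E) : ℝ := Real.exp (-(l / 2) * ‖x‖ ^ 2)

theorem gaussWeight_pos (l : ℝ) (x : E) : 0 < gaussWeight l x := Real.exp_pos _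

theorem continuous_gaussWeight (l : ℝ) : Continuous (gaussWeight (E := E) l) := by
  unfold gaussWeight
  fun_prop

theorem hasFDerivAt_gaussWeight (l : ℝ) (x : E) :
    HasFDerivAt (gaussWeight (E := E) l) (gaussWeight l x • (-(l / 2)) • (2 • innerSL ℝ x)) x :=
  ((hasStrictFDerivAt_norm_sq x).hasFDerivAt.const_mul (-(l / 2))).exp

theorem fderiv_gaussWeight (l : ℝ) (x v : E) :
    fderiv ℝ (gaussWeight l) x v = -(l * inner ℝ v x) * gaussWeight l x := by
  rw [(hasFDerivAt_gaussWeight l x).fderiv]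
  simp only [smul_apply, smul_eq_mul, innerSL_apply_apply, nsmul_eq_mul,
    real_inner_comm]
  push_cast
  ring

theorem gaussWeight_antitone {l l' : ℝ} (h : l ≤ l') (x : E) :
    gaussWeight l' x ≤ gaussWeight l x := by
  unfold gaussWeight
  gcongr

/-- Half of the Gaussian exponent absorbs any power: (1 + r)^k ≤ k! exp(1 + r), and r ≤ 1/l + l r²/4
by completing the square. -/
theorem one_add_pow_mul_gaussWeight_le {l : ℝ} (hl : 0 < l) (k : ℕ) (x : E) :
    (1 + ‖x‖) ^ k * gaussWeight l x
      ≤ (k.factorial * Real.exp (1 + 1 / l)) * Real.exp (-(l / 4) * ‖x‖ ^ 2) := by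
  have h1 : (1 + ‖x‖) ^ k ≤ k.factorial * Real.exp (1 + ‖x‖) := by
    have := Real.pow_div_factorial_le_exp (1 + ‖x‖) (by positivity) k
    rwa [div_le_iff₀' (by positivity)] at this
  have h2 : ‖x‖ ≤ 1 / l + l / 4 * ‖x‖ ^ 2 := by
    have : 1 / l + l / 4 * ‖x‖ ^ 2 - ‖x‖ = (l * ‖x‖ - 2) ^ 2 / (4 * l) := by
      field_simp
      ring
    have h3 : 0 ≤ (l * ‖x‖ - 2) ^ 2 / (4 * l) := by positivity
    linarith
  calc (1 + ‖x‖) ^ k * gaussWeight l x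
      ≤ (k.factorial * Real.exp (1 + (1 / l + l / 4 * ‖x‖ ^ 2))) * gaussWeight l x := by
        have := (gaussWeight_pos l x).le
        refine mul_le_mul_of_nonneg_right (h1.trans ?_) this
        gcongr
    _ = _ := by
        unfold gaussWeight
        rw [mul_assoc, mul_assoc, ← Real.exp_add, ← Real.exp_add]
        congr 2
        ring

namespace PolyDeg

variable {n : ℕ} {f : E → ℝ}

theorem succ (hf : PolyDeg n f) : PolyDeg (n + 1) f := by
  induction hf with
  | const n c => exact const _ c
  | add _ _ h1 h2 => exact h1.add h2
  | mul_inner v _ h => exact h.mul_inner v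

theorem mono (hf : PolyDeg n f) {m : ℕ} (h : n ≤ m) : PolyDeg m f := by
  induction h with
  | refl => exact hf
  | step _ ih => exact ih.succ

theorem const_mul (hf : PolyDeg n f) (c : ℝ) : PolyDeg n (fun x => c * f x) := by
  induction hf with
  | const n c' => exact const _ (c * c')
  | add _ _ h1 h2 => simpa only [mul_add] using h1.add h2
  | mul_inner v _ h => simpa only [mul_left_comm] using h.mul_inner v

theorem prod_inner (m : ℕ) (F : Fin m → E) : PolyDeg m (fun x => ∏ i, inner ℝ (F i) x) := by
  induction m with
  | zero => simpa using const 0 1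
  | succ m ih =>
    simp_rw [Fin.prod_univ_succ]
    exact (ih fun i => F i.succ).mul_inner (F 0)

theorem polyGrowth (hf : PolyDeg n f) : PolyGrowth f := by
  induction hf with
  | const n c => exact PolyGrowth.const c
  | add _ _ h1 h2 => exact h1.add h2
  | mul_inner v _ h => exact (PolyGrowth.inner v).mul h

theorem differentiable (hf : PolyDeg n f) : Differentiable ℝ f := by
  induction hf with
  | const n c => fun_prop
  | add _ _ h1 h2 => exact h1.add h2
  | mul_inner v _ h => exact (innerSL ℝ v).differentiable.mul h

/-- The vanishing clause repairs the truncated subtraction `n - 1` at `n = 0`: in the product rule,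
multiplying the derivative of a constant by a linear factor must not raise the degree to 1. -/
theorem fderiv_aux (hf : PolyDeg n f) (w : E) :
    PolyDeg (n - 1) (fun x => fderiv ℝ f x w) ∧ (n = 0 → ∀ x, fderiv ℝ f x w = 0) := by
  induction hf with
  | const n c => simpa using const (n - 1) 0
  | @add n f g hf hg h1 h2 =>
    have h : ∀ x, fderiv ℝ (fun x => f x + g x) x w = fderiv ℝ f x w + fderiv ℝ g x w := by
      intro x
      rw [fderiv_fun_add (hf.differentiable x) (hg.differentiable x)]
      rfl
    simp_rw [h]
    exact ⟨h1.1.add h2.1, fun hn x => by rw [h1.2 hn, h2.2 hn, add_zero]⟩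
  | @mul_inner n f v hf h1 =>
    have h : ∀ x, fderiv ℝ (fun x => inner ℝ v x * f x) x w
        = inner ℝ v w * f x + inner ℝ v x * fderiv ℝ f x w := by
      intro x
      have hv : HasFDerivAt (fun x : E => inner ℝ v x) (innerSL ℝ v) x :=
        (innerSL ℝ v).hasFDerivAt
      rw [(hv.fun_mul (hf.differentiable x).hasFDerivAt).fderiv]
      simp only [add_apply, smul_apply, smul_eq_mul,
        innerSL_apply_apply]
      ring
    simp_rw [h]
    refine ⟨?_, fun hn => by omega⟩
    rw [Nat.add_sub_cancel]
    refine (hf.const_mul _).add ?_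
    cases n with
    | zero => simpa [h1.2 rfl] using const 0 0
    | succ k => exact h1.1.mul_inner v

theorem fderiv_right (hf : PolyDeg n f) (w : E) : PolyDeg (n - 1) (fun x => fderiv ℝ f x w) :=
  (hf.fderiv_aux w).1

theorem fderiv_eq_zero (hf : PolyDeg 0 f) (w x : E) : fderiv ℝ f x w = 0 :=
  (hf.fderiv_aux w).2 rfl x

end PolyDeg

variable [FiniteDimensional ℝ E] [MeasurableSpace E] [BorelSpace E]

theorem integrable_gaussWeight {l : ℝ} (hl : 0 < l) :
    Integrable (gaussWeight (E := E) l) := by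
  have h := (GaussianFourier.integrable_cexp_neg_mul_sq_norm_add (V := E) (b := ((l / 2 : ℝ) : ℂ))
    (by simpa using hl) 0 0).norm
  refine h.congr (ae_of_all _ fun x => ?_)
  simp only [Complex.norm_exp, gaussWeight]
  congr 1
  simp [← Complex.ofReal_pow]

theorem PolyGrowth.integrable {f : E → ℝ} (hf : PolyGrowth f) {l : ℝ} (hl : 0 < l) :
    Integrable (fun x => f x * gaussWeight l x) := by
  obtain ⟨hfc, C, k, hC, hf⟩ := hf
  refine Integrable.mono' ((integrable_gaussWeight (E := E) (l := l / 2) (by positivity)).const_mul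
    (C * (k.factorial * Real.exp (1 + 1 / l))))
    (hfc.mul (continuous_gaussWeight l)).aestronglyMeasurable (ae_of_all _ fun x => ?_)
  rw [norm_mul, Real.norm_eq_abs, Real.norm_eq_abs, abs_of_pos (gaussWeight_pos l x)]
  calc |f x| * gaussWeight l x ≤ C * (1 + ‖x‖) ^ k * gaussWeight l x := by
        exact mul_le_mul_of_nonneg_right (hf x) (gaussWeight_pos l x).le
    _ ≤ C * ((k.factorial * Real.exp (1 + 1 / l)) * Real.exp (-(l / 4) * ‖x‖ ^ 2)) := by
        rw [mul_assoc]
        exact mul_le_mul_of_nonneg_left (one_add_pow_mul_gaussWeight_le hl k x) hC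
    _ = _ := by
        unfold gaussWeight
        rw [mul_assoc]
        ring_nf

/-- Gaussian integration by parts. -/
theorem integral_inner_mul_gaussWeight {l : ℝ} (hl : 0 < l) (v : E) {u : E → ℝ}
    (hu : Differentiable ℝ u) (hg : PolyGrowth u) (hg' : PolyGrowth fun x => fderiv ℝ u x v) :
    ∫ x, l * inner ℝ v x * u x * gaussWeight l x = ∫ x, fderiv ℝ u x v * gaussWeight l x := by
  have h := integral_mul_fderiv_eq_neg_fderiv_mul_of_integrable (μ := (volume : Measure E))
    (f := u) (g := gaussWeight l) (v := v) (hg'.integrable hl)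
    (by
      have := (((PolyGrowth.inner v).const_mul (-l)).mul hg).integrable hl
      refine this.congr (ae_of_all _ fun x => ?_)
      simp only [fderiv_gaussWeight]
      ring)
    (hg.integrable hl) (fun x _ => hu x)
    (fun x _ => (hasFDerivAt_gaussWeight l x).differentiableAt)
  rw [← neg_eq_iff_eq_neg, ← integral_neg] at h
  rw [← h]
  refine integral_congr_ae (ae_of_all _ fun x => ?_)
  simp only [fderiv_gaussWeight]
  ring

end GaussianWeight

/-! ### Bernstein-Markov inequality and dependence on the width of the Gaussian. -/

section GaussianIntegral

variable {E : Type*} [NormedAddCommGroup E] [InnerProductSpace ℝ E] [FiniteDimensional ℝ E]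
  [MeasurableSpace E] [BorelSpace E]

/-- The integral of `u` against the Gaussian weight `exp (-l ‖x‖² / 2)`. -/
def gaussInt (l : ℝ) (u : E → ℝ) : ℝ := ∫ x, u x * gaussWeight l x

variable {l : ℝ} {f g : E → ℝ} {n : ℕ}

theorem gaussInt_add (hl : 0 < l) (hf : PolyGrowth f) (hg : PolyGrowth g) :
    gaussInt l (fun x => f x + g x) = gaussInt l f + gaussInt l g := by
  simp only [gaussInt, add_mul]
  exact integral_add (hf.integrable hl) (hg.integrable hl)

theorem gaussInt_sub (hl : 0 < l) (hf : PolyGrowth f) (hg : PolyGrowth g) :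
    gaussInt l (fun x => f x - g x) = gaussInt l f - gaussInt l g := by
  simp only [gaussInt, sub_mul]
  exact integral_sub (hf.integrable hl) (hg.integrable hl)

theorem gaussInt_const_mul (c : ℝ) (f : E → ℝ) :
    gaussInt l (fun x => c * f x) = c * gaussInt l f := by
  simp only [gaussInt, mul_assoc]
  exact integral_const_mul _ _

theorem gaussInt_nonneg (h : ∀ x, 0 ≤ f x) : 0 ≤ gaussInt l f :=
  integral_nonneg fun x => mul_nonneg (h x) (gaussWeight_pos l x).le

theorem gaussInt_mono (hl : 0 < l) (hf : PolyGrowth f) (hg : PolyGrowth g) (h : ∀ x, f x ≤ g x) :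
    gaussInt l f ≤ gaussInt l g :=
  integral_mono (hf.integrable hl) (hg.integrable hl) fun x =>
    mul_le_mul_of_nonneg_right (h x) (gaussWeight_pos l x).le

/-- Gaussian integration by parts for a product. -/
theorem gaussInt_inner_mul_mul (hl : 0 < l) (v : E) (hf : Differentiable ℝ f) (hg : Differentiable ℝ g)
    (hf0 : PolyGrowth f) (hg0 : PolyGrowth g) (hf1 : PolyGrowth fun x => fderiv ℝ f x v)
    (hg1 : PolyGrowth fun x => fderiv ℝ g x v) :
    l * gaussInt l (fun x => inner ℝ v x * (f x * g x))
      = gaussInt l (fun x => f x * fderiv ℝ g x v) + gaussInt l (fun x => fderiv ℝ f x v * g x) := by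
  have hd : ∀ x, fderiv ℝ (fun x => f x * g x) x v
      = f x * fderiv ℝ g x v + fderiv ℝ f x v * g x := by
    intro x
    rw [((hf x).hasFDerivAt.fun_mul (hg x).hasFDerivAt).fderiv]
    simp only [add_apply, smul_apply, smul_eq_mul]
    ring
  have h := integral_inner_mul_gaussWeight hl v (u := fun x => f x * g x) (hf.mul hg) (hf0.mul hg0)
    (by simp_rw [hd]; exact (hf0.mul hg1).add (hf1.mul hg0))
  simp_rw [hd] at h
  rw [← gaussInt_add hl (hf0.mul hg1) (hf1.mul hg0), ← gaussInt_const_mul]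
  simpa only [gaussInt, mul_assoc] using h

/-- The Bernstein-Markov inequality in `L²` of a Gaussian weight. -/
theorem PolyDeg.gaussInt_fderiv_sq_le (hl : 0 < l) {v : E} (hv : ‖v‖ = 1) :
    ∀ (n : ℕ) {f : E → ℝ}, PolyDeg n f →
      gaussInt l (fun x => fderiv ℝ f x v ^ 2) ≤ l * n * gaussInt l (fun x => f x ^ 2) := by
  intro n
  induction n with
  | zero =>
    intro f hf
    simp [hf.fderiv_eq_zero, gaussInt]
  | succ n ih =>
    intro f hf
    set g : E → ℝ := fun x => fderiv ℝ f x v with hg_def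
    have hg : PolyDeg n g := hf.fderiv_right v
    set h : E → ℝ := fun x => fderiv ℝ g x v with hh_def
    have hh : PolyDeg (n - 1) h := hg.fderiv_right v
    set k : E → ℝ := fun x => fderiv ℝ h x v with hk_def
    have hk : PolyDeg (n - 1 - 1) k := hh.fderiv_right v
    have pf := hf.polyGrowth
    have pg := hg.polyGrowth
    have ph := hh.polyGrowth
    have pk := hk.polyGrowth
    have pv : PolyGrowth fun x => inner ℝ v x := PolyGrowth.inner v
    -- With ∂* = l⟨v, ·⟩ - ∂ the adjoint of ∂ = ∂_v for the weight, s = ∂*∂f is the number operator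
    -- applied to f.
    set s : E → ℝ := fun x => l * (inner ℝ v x * g x) - h x with hs_def
    have hs : PolyDeg (n + 1) s := by
      convert ((hg.mul_inner v).const_mul l).add ((hh.const_mul (-1)).mono (by omega : n - 1 ≤ n + 1))
        using 2
      simp only [hs_def]
      ring
    have ps := hs.polyGrowth
    have hds : ∀ x, fderiv ℝ s x v = l * g x + l * (inner ℝ v x * h x) - k x := by
      intro x
      have h1 : HasFDerivAt (fun x : E => inner ℝ v x) (innerSL ℝ v) x :=
        (innerSL ℝ v).hasFDerivAt
      rw [(((h1.fun_mul (hg.differentiable x).hasFDerivAt).const_mul l).fun_sub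
        (hh.differentiable x).hasFDerivAt).fderiv]
      simp only [add_apply, smul_apply, sub_apply, smul_eq_mul, innerSL_apply_apply,
        real_inner_self_eq_norm_sq, hv, hh_def, hk_def]
      ring
    have pds : PolyGrowth fun x => fderiv ℝ s x v := by
      simp_rw [hds]
      exact ((pg.const_mul l).add ((pv.mul ph).const_mul l)).sub pk
    have e1 := gaussInt_inner_mul_mul hl v hf.differentiable hg.differentiable pf pg pg ph
    have e2 := gaussInt_inner_mul_mul hl v hg.differentiable hs.differentiable pg ps ph pds
    have e3 := gaussInt_inner_mul_mul hl v hg.differentiable hh.differentiable pg ph ph pk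
    -- `⟨f, s⟩ = ‖g‖²`
    have a1 : gaussInt l (fun x => f x * s x) = gaussInt l (fun x => g x ^ 2) := by
      have : (fun x => f x * s x)
          = fun x => l * (inner ℝ v x * (f x * g x)) - f x * h x := by
        funext x; simp only [hs_def]; ring
      rw [this, gaussInt_sub hl ((pv.mul (pf.mul pg)).const_mul l) (pf.mul ph),
        gaussInt_const_mul, e1]
      simp only [pow_two, hg_def, hh_def]
      ring
    -- `‖s‖² = ‖h‖² + l ‖g‖²`
    have a2 : gaussInt l (fun x => s x ^ 2) = gaussInt l (fun x => g x * fderiv ℝ s x v) := by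
      have : (fun x => s x ^ 2) = fun x => l * (inner ℝ v x * (g x * s x)) - h x * s x := by
        funext x; simp only [hs_def]; ring
      rw [this, gaussInt_sub hl ((pv.mul (pg.mul ps)).const_mul l) (ph.mul ps),
        gaussInt_const_mul, e2]
      simp only [hh_def]
      ring
    -- This is the commutation relation ∂∂* = ∂*∂ + l applied to g, using ‖v‖ = 1.
    have a3 : gaussInt l (fun x => g x * fderiv ℝ s x v)
        = l * gaussInt l (fun x => g x ^ 2) + gaussInt l (fun x => h x ^ 2) := by
      have : (fun x => g x * fderiv ℝ s x v) = fun x =>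
          (l * g x ^ 2 + l * (inner ℝ v x * (g x * h x))) - g x * k x := by
        funext x; rw [hds]; ring
      rw [this, gaussInt_sub hl ((pg.sq.const_mul l).add ((pv.mul (pg.mul ph)).const_mul l))
        (pg.mul pk), gaussInt_add hl (pg.sq.const_mul l) ((pv.mul (pg.mul ph)).const_mul l),
        gaussInt_const_mul, gaussInt_const_mul, e3]
      simp only [pow_two, hh_def, hk_def]
      ring
    -- Induction on the degree gives ‖h‖² ≤ l n ‖g‖², hence ‖s‖² ≤ l(n+1) ‖g‖². Expanding 0 ≤
    -- ‖l(n+1) f - s‖² with ⟨f, s⟩ = ‖g‖² then gives the claim.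
    have a4 := ih hg
    -- `0 ≤ ‖f - t s‖²`
    have hn : (0 : ℝ) < l * (n + 1) := by positivity
    have a5 : 0 ≤ gaussInt l (fun x => (l * (n + 1) * f x - s x) ^ 2) :=
      gaussInt_nonneg fun x => sq_nonneg _
    have a6 : gaussInt l (fun x => (l * (n + 1) * f x - s x) ^ 2)
        = (l * (n + 1)) ^ 2 * gaussInt l (fun x => f x ^ 2)
          - 2 * (l * (n + 1)) * gaussInt l (fun x => f x * s x) + gaussInt l (fun x => s x ^ 2) := by
      rw [← gaussInt_const_mul, ← gaussInt_const_mul,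
        ← gaussInt_sub hl (pf.sq.const_mul _) ((pf.mul ps).const_mul _),
        ← gaussInt_add hl ((pf.sq.const_mul _).sub ((pf.mul ps).const_mul _)) ps.sq]
      congr 1
      funext x
      ring
    have a7 : gaussInt l (fun x => s x ^ 2) ≤ l * (n + 1) * gaussInt l (fun x => g x ^ 2) := by
      rw [a2, a3]
      linarith
    rw [a6, a1] at a5
    have a8 : (l * (n + 1)) * gaussInt l (fun x => g x ^ 2)
        ≤ (l * (n + 1)) * (l * (n + 1) * gaussInt l (fun x => f x ^ 2)) := by
      linarith
    push_cast
    exact le_of_mul_le_mul_left a8 hn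

/-- Integration by parts gives l ∫ ⟨v,x⟩² f² = ∫ f² + 2 ∫ ⟨v,x⟩ f ∂_v f. Young's inequality absorbs
half of the left side, and Bernstein-Markov bounds the remaining ∫ (∂_v f)². -/
theorem PolyDeg.gaussInt_inner_sq_mul_sq_le (hl : 0 < l) {v : E} (hv : ‖v‖ = 1)
    (hf : PolyDeg n f) :
    gaussInt l (fun x => inner ℝ v x ^ 2 * f x ^ 2)
      ≤ (2 + 4 * n) / l * gaussInt l (fun x => f x ^ 2) := by
  have pf := hf.polyGrowth
  have pg := (hf.fderiv_right v).polyGrowth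
  have pv : PolyGrowth fun x => inner ℝ v x := PolyGrowth.inner v
  have hvf := hf.mul_inner v
  have hd : ∀ x, fderiv ℝ (fun x => inner ℝ v x * f x) x v
      = f x + inner ℝ v x * fderiv ℝ f x v := by
    intro x
    have h1 : HasFDerivAt (fun x : E => inner ℝ v x) (innerSL ℝ v) x :=
      (innerSL ℝ v).hasFDerivAt
    rw [(h1.fun_mul (hf.differentiable x).hasFDerivAt).fderiv]
    simp only [add_apply, smul_apply, smul_eq_mul, innerSL_apply_apply,
      real_inner_self_eq_norm_sq, hv]
    ring
  have e := gaussInt_inner_mul_mul hl v hf.differentiable hvf.differentiable pf hvf.polyGrowth pg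
    (hvf.fderiv_right v).polyGrowth
  simp_rw [hd] at e
  have px := hvf.polyGrowth
  have e' : l * gaussInt l (fun x => inner ℝ v x ^ 2 * f x ^ 2) = gaussInt l (fun x => f x ^ 2)
      + 2 * gaussInt l (fun x => inner ℝ v x * f x * fderiv ℝ f x v) := by
    rw [← gaussInt_const_mul (2 : ℝ), ← gaussInt_add hl pf.sq ((px.mul pg).const_mul 2)]
    rw [← gaussInt_add hl (pf.mul (pf.add (pv.mul pg))) (pg.mul px)] at e
    convert e using 3
    · funext x; ring
    · ring
  have h1 : 2 * gaussInt l (fun x => inner ℝ v x * f x * fderiv ℝ f x v)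
      ≤ l / 2 * gaussInt l (fun x => inner ℝ v x ^ 2 * f x ^ 2)
        + 2 / l * gaussInt l (fun x => fderiv ℝ f x v ^ 2) := by
    rw [← gaussInt_const_mul, ← gaussInt_const_mul, ← gaussInt_const_mul,
      ← gaussInt_add hl ((pv.sq.mul pf.sq).const_mul _) (pg.sq.const_mul _)]
    refine gaussInt_mono hl ((px.mul pg).const_mul _)
      (((pv.sq.mul pf.sq).const_mul _).add (pg.sq.const_mul _)) fun x => ?_
    have h2 : l / 2 * (inner ℝ v x ^ 2 * f x ^ 2) + 2 / l * fderiv ℝ f x v ^ 2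
        - 2 * (inner ℝ v x * f x * fderiv ℝ f x v)
        = (l * (inner ℝ v x * f x) - 2 * fderiv ℝ f x v) ^ 2 / (2 * l) := by
      field_simp
      ring
    have h3 : 0 ≤ (l * (inner ℝ v x * f x) - 2 * fderiv ℝ f x v) ^ 2 / (2 * l) := by positivity
    linarith
  have h4 : 2 / l * gaussInt l (fun x => fderiv ℝ f x v ^ 2)
      ≤ 2 * n * gaussInt l (fun x => f x ^ 2) := by
    calc _ ≤ 2 / l * (l * n * gaussInt l (fun x => f x ^ 2)) := by
          gcongr
          exact PolyDeg.gaussInt_fderiv_sq_le hl hv n hf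
      _ = _ := by field_simp
  rw [div_mul_eq_mul_div, le_div_iff₀ hl]
  linarith

theorem PolyDeg.gaussInt_norm_sq_mul_sq_le (hl : 0 < l) (hf : PolyDeg n f) :
    gaussInt l (fun x => ‖x‖ ^ 2 * f x ^ 2)
      ≤ Module.finrank ℝ E * (2 + 4 * n) / l * gaussInt l (fun x => f x ^ 2) := by
  let b := stdOrthonormalBasis ℝ E
  have h1 : gaussInt l (fun x => ‖x‖ ^ 2 * f x ^ 2)
      = ∑ i, gaussInt l (fun x => inner ℝ (b i) x ^ 2 * f x ^ 2) := by
    simp only [gaussInt]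
    rw [← integral_finsetSum _ fun i _ =>
      ((PolyGrowth.inner (b i)).sq.mul hf.polyGrowth.sq).integrable hl]
    simp_rw [← Finset.sum_mul, ← b.sum_sq_norm_inner_right, Real.norm_eq_abs, sq_abs]
  rw [h1]
  refine (Finset.sum_le_sum fun i _ => hf.gaussInt_inner_sq_mul_sq_le hl (b.orthonormal.1 i)).trans ?_
  rw [Finset.sum_const, Finset.card_univ, Fintype.card_fin, nsmul_eq_mul]
  apply le_of_eq
  ring

theorem PolyGrowth.hasDerivAt_gaussInt (hl : 0 < l) (hf : PolyGrowth f) :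
    HasDerivAt (fun l => gaussInt l f) (-(1 / 2) * gaussInt l (fun x => ‖x‖ ^ 2 * f x)) l := by
  have hp := (PolyGrowth.norm_sq (E := E)).mul hf
  have h := (hasDerivAt_integral_of_dominated_loc_of_deriv_le (μ := (volume : Measure E))
    (F := fun l x => f x * gaussWeight l x)
    (F' := fun l x => -(1 / 2) * (‖x‖ ^ 2 * f x * gaussWeight l x))
    -- For parameters above l/2 the wider weight at l/2 dominates.
    (bound := fun x => 1 / 2 * ‖‖x‖ ^ 2 * f x * gaussWeight (l / 2) x‖)
    (x₀ := l) (s := Set.Ioi (l / 2)) (Ioi_mem_nhds (by linarith))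
    (Filter.Eventually.of_forall fun l' =>
      (hf.1.mul (continuous_gaussWeight l')).aestronglyMeasurable) (hf.integrable hl)
    (continuous_const.mul (hp.1.mul (continuous_gaussWeight l))).aestronglyMeasurable
    (ae_of_all _ fun x l' hl' => ?_) ((hp.integrable (half_pos hl)).norm.const_mul _)
    (ae_of_all _ fun x l' _ => ?_)).2
  · refine h.congr_deriv ?_
    exact integral_const_mul _ _
  · simp only [norm_mul, norm_neg, Real.norm_eq_abs, abs_of_pos (gaussWeight_pos _ x)]
    rw [abs_of_pos (by norm_num : (0 : ℝ) < 1 / 2)]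
    gcongr
    exact gaussWeight_antitone (le_of_lt hl') x
  · have h1 : HasDerivAt (fun l : ℝ => -(l / 2) * ‖x‖ ^ 2) (-(1 / 2) * ‖x‖ ^ 2) l' :=
      (((hasDerivAt_id l').div_const 2).neg).mul_const _
    refine (h1.exp.const_mul (f x)).congr_deriv ?_
    simp only [gaussWeight]
    ring

/-- The central estimate: differentiating the integral in t brings down -|x|²/2, which the second
moment bound controls by M/t. Thus t^M times the integral is nondecreasing, and its values at l and
1 are compared. -/
theorem PolyDeg.gaussInt_sq_le (hl : 0 < l) (hl1 : l ≤ 1) (hf : PolyDeg n f) :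
    gaussInt l (fun x => f x ^ 2) ≤
      (l⁻¹ ^ Module.finrank ℝ E) * (l⁻¹ ^ (2 * Module.finrank ℝ E)) ^ n
        * gaussInt 1 (fun x => f x ^ 2) := by
  -- Half of the moment constant D(2 + 4n), so that the derivative of t^M compensates the loss
  -- exactly.
  set M : ℕ := Module.finrank ℝ E * (1 + 2 * n) with hM
  have hd : ∀ t ∈ Set.Ioi (0 : ℝ), HasDerivAt (fun t => t ^ M * gaussInt t (fun x => f x ^ 2))
      (M * t ^ (M - 1) * gaussInt t (fun x => f x ^ 2)
        + t ^ M * (-(1 / 2) * gaussInt t (fun x => ‖x‖ ^ 2 * f x ^ 2))) t := fun t ht =>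
    (hasDerivAt_pow M t).mul (hf.polyGrowth.sq.hasDerivAt_gaussInt ht)
  have hmono : MonotoneOn (fun t => t ^ M * gaussInt t (fun x => f x ^ 2)) (Set.Ioi (0 : ℝ)) := by
    refine monotoneOn_of_deriv_nonneg (convex_Ioi 0)
      (fun t ht => (hd t ht).continuousAt.continuousWithinAt)
      (fun t ht => (hd t (interior_subset ht)).differentiableAt.differentiableWithinAt)
      fun t ht => ?_
    have ht := interior_subset ht
    rw [(hd t ht).deriv]
    have ht' : 0 < t := ht
    have h1 := hf.gaussInt_norm_sq_mul_sq_le ht'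
    have h2 : (M : ℝ) * t ^ (M - 1) = t ^ M * (M / t) := by
      rcases Nat.eq_zero_or_pos M with h0 | h0
      · simp [h0]
      · obtain ⟨k, hk⟩ := Nat.exists_eq_succ_of_ne_zero h0.ne'
        rw [hk, Nat.succ_sub_one, pow_succ]
        field_simp
    rw [h2, mul_assoc, ← mul_add]
    refine mul_nonneg (by positivity) ?_
    have h3 : (Module.finrank ℝ E * (2 + 4 * n) / t : ℝ) = 2 * (M / t) := by
      rw [hM]
      push_cast
      ring
    rw [h3] at h1
    linarith
  have h := hmono (Set.mem_Ioi.2 hl) (Set.mem_Ioi.2 one_pos) hl1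
  simp only [one_pow, one_mul] at h
  have h4 : l⁻¹ ^ Module.finrank ℝ E * (l⁻¹ ^ (2 * Module.finrank ℝ E)) ^ n = (l ^ M)⁻¹ := by
    rw [← inv_pow, ← pow_mul, ← pow_add, hM]
    congr 1
    ring
  rw [h4, inv_mul_eq_div, le_div_iff₀ (by positivity), mul_comm]
  exact h

end GaussianIntegral

/-! ### Lebesgue density of the standard Gaussian measure. -/

section StdGaussianDensity

variable (E : Type*) [NormedAddCommGroup E] [InnerProductSpace ℝ E] [FiniteDimensional ℝ E]
  [MeasurableSpace E] [BorelSpace E]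

/-- The normalizing constant `(2π) ^ (- dim E / 2)` of the standard Gaussian density. -/
def gaussConst : ℝ := ((2 * Real.pi) ^ (Module.finrank ℝ E / 2 : ℝ))⁻¹

theorem gaussConst_pos : 0 < gaussConst E := by
  unfold gaussConst
  positivity

theorem gaussConst_ofReal :
    (gaussConst E : ℂ) = ((Real.pi / ((1 / 2 : ℝ) : ℂ)) ^ (Module.finrank ℝ E / 2 : ℂ))⁻¹ := by
  have h : (Real.pi / ((1 / 2 : ℝ) : ℂ)) = ((2 * Real.pi : ℝ) : ℂ) := by
    push_cast
    ring
  rw [h, gaussConst, Complex.ofReal_inv, Complex.ofReal_cpow (by positivity)]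
  push_cast
  rfl

theorem measurable_gaussDensity :
    Measurable fun x : E => ENNReal.ofReal (gaussConst E * gaussWeight 1 x) :=
  ENNReal.measurable_ofReal.comp (measurable_const.mul (continuous_gaussWeight 1).measurable)

/-- Both are finite measures with characteristic function exp(-|t|²/2). -/
theorem stdGaussian_eq_withDensity :
    stdGaussian E
      = volume.withDensity fun x => ENNReal.ofReal (gaussConst E * gaussWeight 1 x) := by
  have hint := (integrable_gaussWeight (E := E) one_pos).const_mul (gaussConst E)
  have := isFiniteMeasure_withDensity_ofReal hint.2
  refine Measure.ext_of_charFun ?_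
  funext t
  rw [charFun_stdGaussian, charFun_apply, integral_withDensity_eq_integral_toReal_smul
    (measurable_gaussDensity E)
    (ae_of_all _ fun x => ENNReal.ofReal_lt_top)]
  have h := GaussianFourier.integral_cexp_neg_mul_sq_norm_add (V := E) (b := ((1 / 2 : ℝ) : ℂ))
    (by simp) Complex.I t
  have h1 : ∀ x : E, (ENNReal.ofReal (gaussConst E * gaussWeight 1 x)).toReal
      • Complex.exp ((inner ℝ x t : ℝ) * Complex.I)
      = (gaussConst E : ℂ) * Complex.exp (-((1 / 2 : ℝ) : ℂ) * (‖x‖ : ℂ) ^ 2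
        + Complex.I * (inner ℝ t x : ℝ)) := by
    intro x
    rw [ENNReal.toReal_ofReal (mul_pos (gaussConst_pos E) (gaussWeight_pos 1 x)).le,
      Complex.real_smul, Complex.ofReal_mul, mul_assoc, gaussWeight, Complex.ofReal_exp,
      ← Complex.exp_add, real_inner_comm]
    congr 2
    push_cast
    ring
  simp_rw [h1]
  rw [integral_const_mul, h, gaussConst_ofReal, inv_mul_cancel_left₀]
  · congr 1
    rw [Complex.I_sq]
    push_cast
    ring
  · have h2 := gaussConst_ofReal E
    intro h0
    rw [h0, inv_zero, Complex.ofReal_eq_zero] at h2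
    exact (gaussConst_pos E).ne' h2

variable {E}

theorem lintegral_stdGaussian (f : E → ℝ≥0∞) :
    ∫⁻ x, f x ∂(stdGaussian E)
      = ∫⁻ x, ENNReal.ofReal (gaussConst E * gaussWeight 1 x) * f x := by
  rw [stdGaussian_eq_withDensity, lintegral_withDensity_eq_lintegral_mul_non_measurable]
  · rfl
  · exact measurable_gaussDensity E
  · exact ae_of_all _ fun x => ENNReal.ofReal_lt_top

theorem integral_stdGaussian {F : Type*} [NormedAddCommGroup F] [NormedSpace ℝ F] (f : E → F) :
    ∫ x, f x ∂(stdGaussian E) = ∫ x, (gaussConst E * gaussWeight 1 x) • f x := by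
  rw [stdGaussian_eq_withDensity, integral_withDensity_eq_integral_toReal_smul
    (measurable_gaussDensity E)
    (ae_of_all _ fun x => ENNReal.ofReal_lt_top)]
  refine integral_congr_ae (ae_of_all _ fun x => ?_)
  simp only
  rw [ENNReal.toReal_ofReal (mul_pos (gaussConst_pos E) (gaussWeight_pos 1 x)).le]

theorem norm_sq_eq_integral_stdGaussian (f : GaussL2 E) :
    ‖f‖ ^ 2 = ∫ x, ‖f x‖ ^ 2 ∂(stdGaussian E) := by
  have h : ((‖f‖ ^ 2 : ℝ) : ℂ) = ((∫ x, ‖f x‖ ^ 2 ∂(stdGaussian E) : ℝ) : ℂ) := by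
    rw [← integral_complex_ofReal]
    push_cast
    have h1 := inner_self_eq_norm_sq_to_K (𝕜 := ℂ) f
    rw [L2.inner_def] at h1
    simp_rw [inner_self_eq_norm_sq_to_K (𝕜 := ℂ)] at h1
    exact h1.symm
  exact_mod_cast h

end StdGaussianDensity

/-! ### Weighted L¹ bounds on polynomials. -/

section WeightedL1

variable {E : Type*} [NormedAddCommGroup E] [InnerProductSpace ℝ E] [FiniteDimensional ℝ E]
  [MeasurableSpace E] [BorelSpace E]

/-- The integral of `‖f x‖ exp ((1 - ε) ‖x‖² / 2)` against the standard Gaussian measure. -/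
def weightedL1 (ε : ℝ) (f : GaussL2 E) : ℝ≥0∞ :=
  ∫⁻ x, ‖f x‖ₑ * ENNReal.ofReal (gaussWeight (ε - 1) x) ∂(stdGaussian E)

/-- Fatou's lemma along an almost everywhere convergent subsequence. The weight need not be in
L²(μ), so L² continuity is unavailable and lower semicontinuity replaces it. -/
theorem weightedL1_le_of_tendsto {ε : ℝ} {F : ℕ → GaussL2 E} {f : GaussL2 E}
    (hF : Filter.Tendsto F Filter.atTop (nhds f)) {a : ℕ → ℝ≥0∞} {b : ℝ≥0∞}
    (ha : Filter.Tendsto a Filter.atTop (nhds b)) (h : ∀ k, weightedL1 ε (F k) ≤ a k) :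
    weightedL1 ε f ≤ b := by
  obtain ⟨ns, hns, hae⟩ := (tendstoInMeasure_of_tendsto_Lp hF).exists_seq_tendsto_ae
  have hb := ha.comp hns.tendsto_atTop
  calc weightedL1 ε f
      = ∫⁻ x, Filter.liminf (fun k => ‖F (ns k) x‖ₑ * ENNReal.ofReal (gaussWeight (ε - 1) x))
          Filter.atTop ∂(stdGaussian E) := by
        refine lintegral_congr_ae (hae.mono fun x hx => ?_)
        exact (ENNReal.Tendsto.mul_const hx.enorm (Or.inr ENNReal.ofReal_ne_top)).liminf_eq.symm
    _ ≤ Filter.liminf (fun k => weightedL1 ε (F (ns k))) Filter.atTop := by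
        refine lintegral_liminf_le' fun k => ?_
        exact (Lp.aestronglyMeasurable (F (ns k))).enorm.mul
          (ENNReal.measurable_ofReal.comp (continuous_gaussWeight _).measurable).aemeasurable
    _ ≤ Filter.liminf (fun k => a (ns k)) Filter.atTop :=
        Filter.liminf_le_liminf (Filter.Eventually.of_forall fun k => h (ns k))
    _ = b := hb.liminf_eq

theorem weightedL1_add_le {ε : ℝ} (f g : GaussL2 E) :
    weightedL1 ε (f + g) ≤ weightedL1 ε f + weightedL1 ε g := by
  unfold weightedL1
  rw [← lintegral_add_left']
  · refine lintegral_mono_ae ((Lp.coeFn_add f g).mono fun x hx => ?_)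
    rw [hx, Pi.add_apply, ← add_mul]
    gcongr
    exact enorm_add_le _ _
  · exact (Lp.aestronglyMeasurable f).enorm.mul
      (ENNReal.measurable_ofReal.comp (continuous_gaussWeight _).measurable).aemeasurable

theorem weightedL1_zero {ε : ℝ} : weightedL1 ε (0 : GaussL2 E) = 0 := by
  unfold weightedL1
  rw [← lintegral_zero]
  refine lintegral_congr_ae ((Lp.coeFn_zero ℂ 2 (stdGaussian E)).mono fun x _ => ?_)
  simp

theorem weightedL1_sum_le {ε : ℝ} (s : Finset ℕ) (f : ℕ → GaussL2 E) :
    weightedL1 ε (∑ n ∈ s, f n) ≤ ∑ n ∈ s, weightedL1 ε (f n) := by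
  classical
  induction s using Finset.induction_on with
  | empty => simp [weightedL1_zero]
  | insert a s ha ih =>
    rw [Finset.sum_insert ha, Finset.sum_insert ha]
    exact (weightedL1_add_le _ _).trans (by gcongr)

/-- The real and imaginary parts of a complex polynomial function of degree at most `n`. -/
theorem exists_polyDeg_of_mem_span {n : ℕ} {f : GaussL2 E}
    (hf : f ∈ Submodule.span ℂ {f : GaussL2 E | ∃ m : ℕ, m ≤ n ∧ ∃ F : Fin m → E,
      (f : E → ℂ) =ᵐ[stdGaussian E] fun x => ∏ i, ((inner ℝ (F i) x : ℝ) : ℂ)}) :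
    ∃ u v : E → ℝ, PolyDeg n u ∧ PolyDeg n v ∧
      (f : E → ℂ) =ᵐ[stdGaussian E] fun x => (u x : ℂ) + (v x : ℂ) * Complex.I := by
  induction hf using Submodule.span_induction with
  | mem f h =>
    obtain ⟨m, hm, F, hF⟩ := h
    refine ⟨_, _, (PolyDeg.prod_inner m F).mono hm, PolyDeg.const n 0, hF.trans ?_⟩
    exact ae_of_all _ fun x => by simp
  | zero =>
    refine ⟨_, _, PolyDeg.const n 0, PolyDeg.const n 0, (Lp.coeFn_zero _ _ _).trans ?_⟩
    exact ae_of_all _ fun x => by simp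
  | add f g _ _ hf hg =>
    obtain ⟨u, v, hu, hv, huv⟩ := hf
    obtain ⟨u', v', hu', hv', huv'⟩ := hg
    refine ⟨_, _, hu.add hu', hv.add hv', (Lp.coeFn_add f g).trans ?_⟩
    filter_upwards [huv, huv'] with x hx hx'
    rw [Pi.add_apply, hx, hx']
    push_cast
    ring
  | smul c f _ hf =>
    obtain ⟨u, v, hu, hv, huv⟩ := hf
    refine ⟨_, _, (hu.const_mul c.re).add (hv.const_mul (-c.im)),
      (hv.const_mul c.re).add (hu.const_mul c.im), (Lp.coeFn_smul c f).trans ?_⟩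
    filter_upwards [huv] with x hx
    rw [Pi.smul_apply, hx, smul_eq_mul]
    conv_lhs => rw [← Complex.re_add_im c]
    push_cast
    linear_combination (c.im : ℂ) * v x * Complex.I_sq

/-- Cauchy-Schwarz against the constant 1, read off from the nonnegative integral of (Z f - ∫ f)²,
with Z the total mass. -/
theorem sq_gaussInt_le {l : ℝ} (hl : 0 < l) {f : E → ℝ} (hf : PolyGrowth f) :
    gaussInt l f ^ 2 ≤ gaussInt l (fun x => f x ^ 2) * gaussInt l (fun _ : E => 1) := by
  set Z := gaussInt l (fun _ : E => 1) with hZ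
  have hZ0 : 0 ≤ Z := gaussInt_nonneg fun _ => zero_le_one
  have h1 : 0 ≤ gaussInt l (fun x => (Z * f x - gaussInt l f) ^ 2) :=
    gaussInt_nonneg fun x => sq_nonneg _
  have h2 : (fun x => (Z * f x - gaussInt l f) ^ 2) = fun x =>
      Z ^ 2 * f x ^ 2 + (-(2 * Z * gaussInt l f)) * f x + gaussInt l f ^ 2 * 1 := by
    funext x; ring
  rw [h2, gaussInt_add hl ((hf.sq.const_mul _).add (hf.const_mul _))
    ((PolyGrowth.const 1).const_mul _), gaussInt_add hl (hf.sq.const_mul _) (hf.const_mul _),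
    gaussInt_const_mul, gaussInt_const_mul, gaussInt_const_mul, ← hZ] at h1
  have hZ1 : 0 < Z := by
    have : 0 < ∫ x : E, gaussWeight l x := by
      unfold gaussWeight
      rw [GaussianFourier.integral_rexp_neg_mul_sq_norm (by positivity)]
      positivity
    simpa [hZ, gaussInt] using this
  have h3 : 0 ≤ Z * (gaussInt l (fun x => f x ^ 2) * Z - gaussInt l f ^ 2) := by
    nlinarith
  have := nonneg_of_mul_nonneg_right h3 hZ1
  linarith

/-- The weight times the Gaussian density is a Gaussian of parameter ε; Cauchy-Schwarz there reduces
to a square integral, and `PolyDeg.gaussInt_sq_le` on real and imaginary parts returns to parameter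
1. -/
theorem exists_weightedL1_span_le {ε : ℝ} (hε : 0 < ε) (hε1 : ε ≤ 1) :
    ∃ K B : ℝ, 0 ≤ K ∧ 1 ≤ B ∧ ∀ n : ℕ, ∀ f : GaussL2 E,
      f ∈ Submodule.span ℂ {f : GaussL2 E | ∃ m : ℕ, m ≤ n ∧ ∃ F : Fin m → E,
        (f : E → ℂ) =ᵐ[stdGaussian E] fun x => ∏ i, ((inner ℝ (F i) x : ℝ) : ℂ)} →
      weightedL1 ε f ≤ ENNReal.ofReal (K * B ^ n * ‖f‖) := by
  have hc := gaussConst_pos E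
  set D := Module.finrank ℝ E with hD
  set Z := gaussInt ε (fun _ : E => 1) with hZ
  have hZ0 : 0 ≤ Z := gaussInt_nonneg fun _ => zero_le_one
  have hinv : 1 ≤ ε⁻¹ := (one_le_inv₀ hε).2 hε1
  have hB : 1 ≤ ε⁻¹ ^ (2 * D) := one_le_pow₀ hinv
  refine ⟨Real.sqrt (gaussConst E * Z * ε⁻¹ ^ D), ε⁻¹ ^ (2 * D), Real.sqrt_nonneg _, hB,
    fun n f hf => ?_⟩
  obtain ⟨u, v, hu, hv, huv⟩ := exists_polyDeg_of_mem_span hf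
  set p : E → ℝ := fun x => u x ^ 2 + v x ^ 2 with hp
  have pp : PolyGrowth p := hu.polyGrowth.sq.add hv.polyGrowth.sq
  set q : E → ℝ := fun x => ‖(u x : ℂ) + (v x : ℂ) * Complex.I‖ with hq
  have hqp : ∀ x, q x ^ 2 = p x := fun x => by
    simp only [hq, hp, Complex.sq_norm]
    exact Complex.normSq_add_mul_I _ _
  have hq0 : ∀ x, 0 ≤ q x := fun x => norm_nonneg _
  -- The modulus q is not a polynomial, but q ≤ 1 + q² and q² = p is one.
  have pq : PolyGrowth q := by
    obtain ⟨C, k, hC, h⟩ := ((PolyGrowth.const (1 : ℝ)).add pp).2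
    refine ⟨?_, C, k, hC, fun x => le_trans ?_ (h x)⟩
    · have h1 := hu.polyGrowth.1
      have h2 := hv.polyGrowth.1
      fun_prop
    · rw [abs_of_nonneg (hq0 x)]
      refine le_trans ?_ (le_abs_self _)
      simp only [← hqp]
      nlinarith [sq_nonneg (q x - 1), hq0 x]
  have hnorm : ‖f‖ ^ 2 = gaussConst E * gaussInt 1 p := by
    rw [norm_sq_eq_integral_stdGaussian, integral_congr_ae (huv.mono fun x hx => by
      show ‖f x‖ ^ 2 = q x ^ 2
      rw [hx]), integral_stdGaussian, gaussInt, ← integral_const_mul]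
    refine integral_congr_ae (ae_of_all _ fun x => ?_)
    simp only [hqp, smul_eq_mul]
    ring
  have hG : gaussInt ε p ≤ ε⁻¹ ^ D * (ε⁻¹ ^ (2 * D)) ^ n * gaussInt 1 p := by
    simp only [hp]
    rw [gaussInt_add hε hu.polyGrowth.sq hv.polyGrowth.sq,
      gaussInt_add one_pos hu.polyGrowth.sq hv.polyGrowth.sq, mul_add]
    exact add_le_add (hu.gaussInt_sq_le hε hε1) (hv.gaussInt_sq_le hε hε1)
  have hrho : weightedL1 ε f = ENNReal.ofReal (gaussConst E * gaussInt ε q) := by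
    unfold weightedL1
    rw [lintegral_congr_ae (huv.mono fun x hx => by
      show ‖f x‖ₑ * _ = ENNReal.ofReal (q x) * ENNReal.ofReal (gaussWeight (ε - 1) x)
      rw [hx, ofReal_norm]), lintegral_stdGaussian, gaussInt, ← integral_const_mul,
      ofReal_integral_eq_lintegral_ofReal ((pq.integrable hε).const_mul _)
        (ae_of_all _ fun x => mul_nonneg hc.le (mul_nonneg (hq0 x) (gaussWeight_pos _ x).le))]
    refine lintegral_congr fun x => ?_
    rw [← ENNReal.ofReal_mul (hq0 x),
      ← ENNReal.ofReal_mul (mul_pos hc (gaussWeight_pos _ x)).le]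
    congr 1
    have : gaussWeight ε x = gaussWeight 1 x * gaussWeight (ε - 1) x := by
      rw [gaussWeight, gaussWeight, gaussWeight, ← Real.exp_add]
      ring_nf
    rw [this]
    ring
  rw [hrho]
  refine ENNReal.ofReal_le_ofReal (abs_le_of_sq_le_sq' ?_ (by positivity)).2
  have h1 := sq_gaussInt_le hε pq
  simp_rw [hqp] at h1
  rw [mul_pow, mul_pow, mul_pow, Real.sq_sqrt (by positivity), hnorm]
  have hI : 0 ≤ gaussInt 1 p := gaussInt_nonneg fun x => by positivity
  have hBn : 1 ≤ (ε⁻¹ ^ (2 * D)) ^ n := one_le_pow₀ hB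
  calc gaussConst E ^ 2 * gaussInt ε q ^ 2
      ≤ gaussConst E ^ 2 * (ε⁻¹ ^ D * (ε⁻¹ ^ (2 * D)) ^ n * gaussInt 1 p * Z) := by
        gcongr
        exact h1.trans (mul_le_mul_of_nonneg_right hG hZ0)
    _ = gaussConst E * Z * ε⁻¹ ^ D * (ε⁻¹ ^ (2 * D)) ^ n * (gaussConst E * gaussInt 1 p) := by
        ring
    -- Squaring a factor that is at least 1 wastes a little but avoids a square root of B.
    _ ≤ gaussConst E * Z * ε⁻¹ ^ D * ((ε⁻¹ ^ (2 * D)) ^ n) ^ 2 * (gaussConst E * gaussInt 1 p) := by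
        gcongr
        nlinarith

theorem exists_weightedL1_polyLE_le {ε : ℝ} (hε : 0 < ε) (hε1 : ε ≤ 1) :
    ∃ K B : ℝ, 0 ≤ K ∧ 1 ≤ B ∧ ∀ n : ℕ, ∀ f ∈ polyLE E n,
      weightedL1 ε f ≤ ENNReal.ofReal (K * B ^ n * ‖f‖) := by
  obtain ⟨K, B, hK, hB, h⟩ := exists_weightedL1_span_le (E := E) hε hε1
  refine ⟨K, B, hK, hB, fun n f hf => ?_⟩
  rw [polyLE, ← SetLike.mem_coe, Submodule.topologicalClosure_coe] at hf
  obtain ⟨F, hFm, hF⟩ := mem_closure_iff_seq_limit.1 hf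
  exact weightedL1_le_of_tendsto hF
    (ENNReal.tendsto_ofReal (hF.norm.const_mul (K * B ^ n))) fun k => h n _ (hFm k)

end WeightedL1

/-! ### Exponentials as test functions, chaos expansion, continuity on (E). -/

section Chaos

variable {E : Type*} [NormedAddCommGroup E] [InnerProductSpace ℝ E] [FiniteDimensional ℝ E]
  [MeasurableSpace E] [BorelSpace E]

theorem integrable_stdGaussian_iff {F : Type*} [NormedAddCommGroup F] [NormedSpace ℝ F]
    (f : E → F) : Integrable f (stdGaussian E) ↔
      Integrable (fun x => (gaussConst E * gaussWeight 1 x) • f x) := by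
  rw [stdGaussian_eq_withDensity, integrable_withDensity_iff_integrable_smul'
    (measurable_gaussDensity E) (ae_of_all _ fun x => ENNReal.ofReal_lt_top)]
  refine integrable_congr (ae_of_all _ fun x => ?_)
  simp only
  rw [ENNReal.toReal_ofReal (mul_pos (gaussConst_pos E) (gaussWeight_pos 1 x)).le]

theorem gaussWeight_mul (l l' : ℝ) (x : E) :
    gaussWeight l x * gaussWeight l' x = gaussWeight (l + l') x := by
  rw [gaussWeight, gaussWeight, gaussWeight, ← Real.exp_add]
  ring_nf

theorem integrable_gaussWeight_stdGaussian {l : ℝ} (hl : -1 < l) :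
    Integrable (gaussWeight (E := E) l) (stdGaussian E) := by
  rw [integrable_stdGaussian_iff]
  simp_rw [smul_eq_mul, mul_assoc, gaussWeight_mul]
  exact (integrable_gaussWeight (by linarith)).const_mul _

theorem PolyGrowth.integrable_stdGaussian {f : E → ℝ} (hf : PolyGrowth f) :
    Integrable f (stdGaussian E) := by
  rw [integrable_stdGaussian_iff]
  refine ((hf.integrable one_pos).const_mul (gaussConst E)).congr (ae_of_all _ fun x => ?_)
  simp only [smul_eq_mul]
  ring

theorem memLp_exp_abs_inner (R : ℝ) (F : E) :
    MemLp (fun x : E => Real.exp (R * |inner ℝ F x|)) 2 (stdGaussian E) := by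
  have hm : Continuous fun x : E => Real.exp (R * |inner ℝ F x|) := by fun_prop
  rw [memLp_two_iff_integrable_sq hm.aestronglyMeasurable]
  -- Completing the square, 2R|⟨F,x⟩| ≤ 4R²|F|² + |x|²/4, and exp(|x|²/4) is still μ-integrable.
  refine Integrable.mono' ((integrable_gaussWeight_stdGaussian (E := E) (l := -(1 / 2))
    (by norm_num)).const_mul (Real.exp (4 * R ^ 2 * ‖F‖ ^ 2)))
    (hm.pow 2).aestronglyMeasurable (ae_of_all _ fun x => ?_)
  rw [Real.norm_of_nonneg (by positivity), gaussWeight, ← Real.exp_add, ← Real.exp_nat_mul]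
  refine Real.exp_le_exp.2 ?_
  have h1 := abs_real_inner_le_norm F x
  have h2 : R * |inner ℝ F x| ≤ |R| * (‖F‖ * ‖x‖) := by
    refine (mul_le_mul_of_nonneg_right (le_abs_self R) (abs_nonneg _)).trans ?_
    gcongr
  have h3 := sq_abs R
  push_cast
  nlinarith [sq_nonneg (2 * (|R| * ‖F‖) - ‖x‖ / 2)]

/-- Termwise, r^m ≤ R^(-n) (R r)^m for every m ≥ n. -/
theorem exp_sub_sum_le {r R : ℝ} (hr : 0 ≤ r) (hR : 1 ≤ R) (n : ℕ) :
    Real.exp r - ∑ m ∈ Finset.range n, r ^ m / m.factorial ≤ (R ^ n)⁻¹ * Real.exp (R * r) := by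
  have hs : ∀ t : ℝ, HasSum (fun m => t ^ m / m.factorial) (Real.exp t) := fun t => by
    rw [Real.exp_eq_exp_ℝ]
    exact NormedSpace.expSeries_div_hasSum_exp t
  have h1 := (hasSum_nat_add_iff' n).2 (hs r)
  have h2 := ((hasSum_nat_add_iff' n).2 (hs (R * r))).mul_left (R ^ n)⁻¹
  have hR0 : 0 < R := by linarith
  refine (hasSum_le (fun m => ?_) h1 h2).trans ?_
  · rw [mul_pow, pow_add R, mul_comm (R ^ m), mul_assoc, mul_div_assoc,
      inv_mul_cancel_left₀ (by positivity), mul_div_assoc]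
    exact le_mul_of_one_le_left (by positivity) (one_le_pow₀ hR)
  · gcongr
    have : 0 ≤ ∑ m ∈ Finset.range n, (R * r) ^ m / (m.factorial : ℝ) := by positivity
    linarith

theorem memLp_exp_inner (F : E) :
    MemLp (fun x : E => Complex.exp (Complex.I * ((inner ℝ x F : ℝ) : ℂ))) 2 (stdGaussian E) := by
  refine MemLp.of_bound (by fun_prop) 1 (ae_of_all _ fun x => ?_)
  rw [Complex.norm_exp_I_mul_ofReal]

/-- The class of `exp (i ⟨·, F⟩)` in `L²`. -/
def expL2 (F : E) : GaussL2 E := (memLp_exp_inner F).toLp _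

theorem memLp_inner_pow (m : ℕ) (F : E) :
    MemLp (fun x : E => ∏ _i : Fin m, ((inner ℝ F x : ℝ) : ℂ)) 2 (stdGaussian E) := by
  have hm : Continuous fun x : E => ∏ _i : Fin m, ((inner ℝ F x : ℝ) : ℂ) := by fun_prop
  rw [memLp_two_iff_integrable_sq_norm hm.aestronglyMeasurable]
  refine (PolyDeg.prod_inner m fun _ => F).polyGrowth.sq.integrable_stdGaussian.congr
    (ae_of_all _ fun x => ?_)
  simp only
  rw [← Complex.ofReal_prod, Complex.norm_real, Real.norm_eq_abs, sq_abs]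

/-- The partial sums of the exponential series of `exp (i ⟨·, F⟩)` in `L²`. -/
def taylorL2 (F : E) (n : ℕ) : GaussL2 E :=
  ∑ m ∈ Finset.range n, (Complex.I ^ m / m.factorial) • (memLp_inner_pow m F).toLp _

theorem taylorL2_mem_polyLE (F : E) (n : ℕ) : taylorL2 F (n + 1) ∈ polyLE E n := by
  refine Submodule.sum_mem _ fun m hm => Submodule.smul_mem _ _ ?_
  refine Submodule.le_topologicalClosure _ (Submodule.subset_span ⟨m, ?_, fun _ => F, ?_⟩)
  · exact Nat.lt_succ_iff.1 (Finset.mem_range.1 hm)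
  · exact MemLp.coeFn_toLp _

theorem coeFn_taylorL2 (F : E) (n : ℕ) : (taylorL2 F n : E → ℂ) =ᵐ[stdGaussian E]
    fun x => ∑ m ∈ Finset.range n,
      (Complex.I * ((inner ℝ x F : ℝ) : ℂ)) ^ m / (m.factorial : ℂ) := by
  induction n with
  | zero =>
    simp only [taylorL2, Finset.range_zero, Finset.sum_empty]
    exact Lp.coeFn_zero _ _ _
  | succ n ih =>
    have h : taylorL2 F (n + 1)
        = taylorL2 F n + (Complex.I ^ n / n.factorial) • (memLp_inner_pow n F).toLp _ := by
      simp only [taylorL2, Finset.sum_range_succ]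
    rw [h]
    filter_upwards [Lp.coeFn_add (taylorL2 F n)
      ((Complex.I ^ n / (n.factorial : ℂ)) • (memLp_inner_pow n F).toLp _), ih,
      Lp.coeFn_smul (Complex.I ^ n / (n.factorial : ℂ)) ((memLp_inner_pow n F).toLp _),
      (memLp_inner_pow n F).coeFn_toLp] with x h1 h2 h3 h4
    rw [h1, Pi.add_apply, h2, h3, Pi.smul_apply, h4, Finset.sum_range_succ, Finset.prod_const,
      Finset.card_univ, Fintype.card_fin, smul_eq_mul, mul_pow, real_inner_comm x F]
    ring

/-- The remainder is dominated pointwise by R^(-n) exp(R|⟨F,x⟩|), which is in L². The freedom in R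
serves all the norms ‖·‖_q. -/
theorem exists_norm_expL2_sub_taylorL2_le (F : E) {R : ℝ} (hR : 1 ≤ R) :
    ∃ C : ℝ, 0 ≤ C ∧ ∀ n, ‖expL2 F - taylorL2 F n‖ ≤ (R ^ n)⁻¹ * C := by
  set G : Lp ℝ 2 (stdGaussian E) := (memLp_exp_abs_inner R F).toLp _ with hG
  refine ⟨‖G‖, norm_nonneg _, fun n => ?_⟩
  have hR0 : 0 ≤ (R ^ n)⁻¹ := by positivity
  have : (R ^ n)⁻¹ * ‖G‖ = ‖(R ^ n)⁻¹ • G‖ := by rw [norm_smul, Real.norm_of_nonneg hR0]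
  rw [this]
  refine Lp.norm_le_norm_of_ae_le ?_
  filter_upwards [Lp.coeFn_sub (expL2 F) (taylorL2 F n), coeFn_taylorL2 F n,
    (memLp_exp_inner F).coeFn_toLp, (memLp_exp_abs_inner R F).coeFn_toLp,
    Lp.coeFn_smul (R ^ n)⁻¹ G] with x h1 h2 h3 h4 h5
  rw [h1, Pi.sub_apply, h2, expL2, h3, h5, Pi.smul_apply, hG, h4, smul_eq_mul,
    Real.norm_of_nonneg (by positivity)]
  refine (Complex.norm_exp_sub_sum_le_exp_norm_sub_sum _ n).trans ?_
  have hn : ‖Complex.I * ((inner ℝ x F : ℝ) : ℂ)‖ = |inner ℝ F x| := by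
    rw [norm_mul, Complex.norm_I, one_mul, Complex.norm_real, Real.norm_eq_abs, real_inner_comm]
  rw [hn]
  exact exp_sub_sum_le (abs_nonneg _) hR n

instance instHasOrthogonalProjectionPolyLE (n : ℕ) : (polyLE E n).HasOrthogonalProjection :=
  haveI : CompleteSpace (polyLE E n) :=
    (Submodule.isClosed_topologicalClosure _).completeSpace_coe
  inferInstance

theorem polyLE_mono : Monotone (polyLE E) := fun _ _ h =>
  Submodule.topologicalClosure_mono (Submodule.span_mono fun _ ⟨k, hk, hF⟩ => ⟨k, hk.trans h, hF⟩)

theorem chaos_le_polyLE (n : ℕ) : chaos E n ≤ polyLE E n := by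
  cases n with
  | zero => exact le_rfl
  | succ n => exact inf_le_left

theorem chaosProj_mem (n : ℕ) (f : GaussL2 E) : chaosProj E n f ∈ chaos E n :=
  Submodule.starProjection_apply_mem _ _

theorem norm_chaosProj_le (n : ℕ) (f : GaussL2 E) : ‖chaosProj E n f‖ ≤ ‖f‖ :=
  Submodule.norm_starProjection_apply_le _ _

/-- The projection kills g, so a chaos component is no larger than the error of any approximation of
lower degree. -/
theorem norm_chaosProj_succ_le (n : ℕ) (f : GaussL2 E) {g : GaussL2 E} (hg : g ∈ polyLE E n) :
    ‖chaosProj E (n + 1) f‖ ≤ ‖f - g‖ := by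
  have h : chaosProj E (n + 1) g = 0 := by
    refine Submodule.eq_starProjection_of_mem_orthogonal (Submodule.zero_mem _) ?_
    rw [sub_zero]
    refine (Submodule.mem_orthogonal' _ _).2 fun y hy => ?_
    exact (Submodule.mem_orthogonal _ _).1 hy.2 g hg
  calc ‖chaosProj E (n + 1) f‖ = ‖chaosProj E (n + 1) (f - g)‖ := by rw [map_sub, h, sub_zero]
    _ ≤ _ := norm_chaosProj_le _ _

theorem expL2_mem_hidaTest (F : E) : expL2 F ∈ hidaTestSubmodule E := by
  intro q
  -- With R = 2^(q+1), a factor 2^(-n) survives the weight 2^(qn).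
  obtain ⟨C, hC, h⟩ := exists_norm_expL2_sub_taylorL2_le F
    (one_le_pow₀ one_le_two : (1 : ℝ) ≤ 2 ^ (q + 1))
  have h' : ∀ n, ‖chaosProj E n (expL2 F)‖ ≤ ((2 ^ (q + 1)) ^ n)⁻¹ * C := by
    intro n
    cases n with
    | zero =>
      refine (norm_chaosProj_le _ _).trans ?_
      simpa [taylorL2] using h 0
    | succ n => exact (norm_chaosProj_succ_le n _ (taylorL2_mem_polyLE F n)).trans (h (n + 1))
  refine memℓp_gen ?_
  have hs : Summable fun n : ℕ => C ^ 2 * (1 / 4 : ℝ) ^ n :=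
    (summable_geometric_of_lt_one (by norm_num) (by norm_num)).mul_left _
  refine Summable.of_nonneg_of_le (fun n => by positivity) (fun n => ?_) hs
  have h1 : ‖chaosSeq E q (expL2 F) n‖ ≤ C * (1 / 2) ^ n := by
    change ‖((2 : ℂ) ^ (q * n)) • chaosProj E n (expL2 F)‖ ≤ _
    rw [norm_smul, norm_pow, Complex.norm_ofNat]
    calc (2 : ℝ) ^ (q * n) * ‖chaosProj E n (expL2 F)‖
        ≤ 2 ^ (q * n) * (((2 ^ (q + 1)) ^ n)⁻¹ * C) := by
          gcongr
          exact h' n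
      _ = C * (1 / 2) ^ n := by
          rw [pow_succ, mul_pow, ← pow_mul, one_div, inv_pow]
          field_simp
  simp only [ENNReal.toReal_ofNat, Real.rpow_ofNat]
  calc ‖chaosSeq E q (expL2 F) n‖ ^ 2 ≤ (C * (1 / 2) ^ n) ^ 2 := by gcongr
    _ = C ^ 2 * (1 / 4 : ℝ) ^ n := by
        rw [mul_pow, ← pow_mul, mul_comm n 2, pow_mul]
        norm_num

/-- The Hida test function `exp (i ⟨·, F⟩)`. -/
def expHidaTest (F : E) : HidaTest E := ⟨expL2 F, expL2_mem_hidaTest F⟩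

theorem coeFn_toL2_expHidaTest (F : E) : (HidaTest.toL2 E (expHidaTest F) : E → ℂ)
    =ᵐ[stdGaussian E] fun x => Complex.exp (Complex.I * ((inner ℝ x F : ℝ) : ℂ)) :=
  (memLp_exp_inner F).coeFn_toLp

theorem expL2_mem_closure_iSup_polyLE (F : E) :
    expL2 F ∈ (⨆ n, polyLE E n).topologicalClosure := by
  obtain ⟨C, hC, h⟩ := exists_norm_expL2_sub_taylorL2_le F (one_le_two : (1 : ℝ) ≤ 2)
  rw [← SetLike.mem_coe, Submodule.topologicalClosure_coe]
  refine mem_closure_of_tendsto (f := fun n => taylorL2 F (n + 1)) (b := Filter.atTop) ?_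
    (Filter.Eventually.of_forall fun n =>
      Submodule.mem_iSup_of_mem n (taylorL2_mem_polyLE F n))
  have h0 : Filter.Tendsto (taylorL2 F) Filter.atTop (nhds (expL2 F)) := by
    rw [tendsto_iff_norm_sub_tendsto_zero]
    refine squeeze_zero (fun n => norm_nonneg _) (fun n => (norm_sub_rev _ _).trans_le (h n)) ?_
    have h2 : Filter.Tendsto (fun n : ℕ => ((1 / 2 : ℝ)) ^ n * C) Filter.atTop (nhds (0 * C)) :=
      (tendsto_pow_atTop_nhds_zero_of_lt_one (by norm_num) (by norm_num)).mul_const C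
    simpa using h2
  exact h0.comp (Filter.tendsto_add_atTop_nat 1)

/-- The positive and negative parts of u are densities of two finite measures with the same
characteristic function, so they agree almost everywhere. -/
theorem ae_eq_zero_of_integral_mul_exp_eq_zero {μ : Measure E} [IsFiniteMeasure μ] {u : E → ℝ}
    (hu : Integrable u μ)
    (h : ∀ t : E, ∫ x, (u x : ℂ) * Complex.exp ((inner ℝ x t : ℝ) * Complex.I) ∂μ = 0) :
    u =ᵐ[μ] 0 := by
  have hm := hu.aemeasurable
  have hm' : AEMeasurable (fun x => -u x) μ := hm.neg
  have : IsFiniteMeasure (μ.withDensity fun x => ENNReal.ofReal (u x)) :=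
    isFiniteMeasure_withDensity_ofReal hu.2
  have : IsFiniteMeasure (μ.withDensity fun x => ENNReal.ofReal (-u x)) :=
    isFiniteMeasure_withDensity_ofReal hu.neg.2
  have key : (μ.withDensity fun x => ENNReal.ofReal (u x))
      = μ.withDensity fun x => ENNReal.ofReal (-u x) := by
    refine Measure.ext_of_charFun (funext fun t => ?_)
    rw [charFun_apply, charFun_apply,
      integral_withDensity_eq_integral_toReal_smul₀ hm.ennreal_ofReal
        (ae_of_all _ fun x => ENNReal.ofReal_lt_top),
      integral_withDensity_eq_integral_toReal_smul₀ hm'.ennreal_ofReal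
        (ae_of_all _ fun x => ENNReal.ofReal_lt_top), ← sub_eq_zero, ← integral_sub, ← h t]
    · refine integral_congr_ae (ae_of_all _ fun x => ?_)
      simp only [ENNReal.toReal_ofReal', Complex.real_smul]
      rw [← sub_mul, ← Complex.ofReal_sub]
      congr 2
      rcases le_total 0 (u x) with h0 | h0
      · rw [max_eq_left h0, max_eq_right (by linarith), sub_zero]
      · rw [max_eq_right h0, max_eq_left (by linarith), zero_sub, neg_neg]
    · have h1 : Integrable (fun x => ((ENNReal.ofReal (u x)).toReal : ℂ)) μ := by
        simp only [ENNReal.toReal_ofReal']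
        exact hu.pos_part.ofReal
      simp only [Complex.real_smul]
      refine h1.mul_bdd (c := 1) (by fun_prop) (ae_of_all _ fun x => ?_)
      rw [Complex.norm_exp_ofReal_mul_I]
    · have h1 : Integrable (fun x => ((ENNReal.ofReal (-u x)).toReal : ℂ)) μ := by
        simp only [ENNReal.toReal_ofReal']
        exact hu.neg_part.ofReal
      simp only [Complex.real_smul]
      refine h1.mul_bdd (c := 1) (by fun_prop) (ae_of_all _ fun x => ?_)
      rw [Complex.norm_exp_ofReal_mul_I]
  rw [withDensity_eq_iff_of_sigmaFinite hm.ennreal_ofReal hm'.ennreal_ofReal] at key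
  filter_upwards [key] with x hx
  rcases lt_trichotomy (u x) 0 with h0 | h0 | h0
  · rw [ENNReal.ofReal_of_nonpos h0.le, eq_comm, ENNReal.ofReal_eq_zero] at hx
    linarith
  · exact h0
  · rw [ENNReal.ofReal_of_nonpos (by linarith : -u x ≤ 0), ENNReal.ofReal_eq_zero] at hx
    linarith

theorem eq_zero_of_forall_inner_expL2_eq_zero {f : GaussL2 E} (h : ∀ F, inner ℂ (expL2 F) f = 0) :
    f = 0 := by
  have hf : Integrable f (stdGaussian E) := (Lp.memLp f).integrable one_le_two
  have h1 : ∀ t : E, ∫ x, f x * Complex.exp ((inner ℝ x t : ℝ) * Complex.I) ∂(stdGaussian E) = 0 := by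
    intro t
    rw [← h (-t), L2.inner_def]
    refine integral_congr_ae ((memLp_exp_inner (-t)).coeFn_toLp.mono fun x hx => ?_)
    simp only [RCLike.inner_apply]
    rw [expL2, hx, ← Complex.exp_conj]
    congr 2
    simp [mul_comm]
  have h2 : ∀ t : E, ∫ x, (starRingEnd ℂ) (f x) * Complex.exp ((inner ℝ x t : ℝ) * Complex.I)
      ∂(stdGaussian E) = 0 := by
    intro t
    have := congrArg (starRingEnd ℂ) (h1 (-t))
    rw [← integral_conj, map_zero] at this
    rw [← this]
    refine integral_congr_ae (ae_of_all _ fun x => ?_)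
    simp only
    rw [map_mul, ← Complex.exp_conj]
    simp
  have hexp : ∀ t : E, ∀ g : E → ℂ, Integrable g (stdGaussian E) → Integrable
      (fun x => g x * Complex.exp ((inner ℝ x t : ℝ) * Complex.I)) (stdGaussian E) := by
    intro t g hg
    refine hg.mul_bdd (c := 1) (by fun_prop) (ae_of_all _ fun x => ?_)
    rw [Complex.norm_exp_ofReal_mul_I]
  have hf' : Integrable (fun x => (starRingEnd ℂ) (f x)) (stdGaussian E) :=
    (integrable_norm_iff (by
      exact Complex.continuous_conj.comp_aestronglyMeasurable hf.1)).1 (by simpa using hf.norm)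
  have hre : (fun x => (f x).re) =ᵐ[stdGaussian E] 0 := by
    refine ae_eq_zero_of_integral_mul_exp_eq_zero hf.re fun t => ?_
    have : ∀ x, ((f x).re : ℂ) * Complex.exp ((inner ℝ x t : ℝ) * Complex.I)
        = (1 / 2) * (f x * Complex.exp ((inner ℝ x t : ℝ) * Complex.I)
          + (starRingEnd ℂ) (f x) * Complex.exp ((inner ℝ x t : ℝ) * Complex.I)) := by
      intro x
      rw [Complex.re_eq_add_conj]
      ring
    simp_rw [this]
    rw [integral_const_mul, integral_add (hexp t _ hf) (hexp t _ hf'), h1, h2]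
    simp
  have him : (fun x => (f x).im) =ᵐ[stdGaussian E] 0 := by
    refine ae_eq_zero_of_integral_mul_exp_eq_zero hf.im fun t => ?_
    have : ∀ x, ((f x).im : ℂ) * Complex.exp ((inner ℝ x t : ℝ) * Complex.I)
        = (1 / (2 * Complex.I)) * (f x * Complex.exp ((inner ℝ x t : ℝ) * Complex.I)
          - (starRingEnd ℂ) (f x) * Complex.exp ((inner ℝ x t : ℝ) * Complex.I)) := by
      intro x
      rw [Complex.im_eq_sub_conj]
      ring
    simp_rw [this]
    rw [integral_const_mul, integral_sub (hexp t _ hf) (hexp t _ hf'), h1, h2]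
    simp
  refine Lp.ext ?_
  filter_upwards [hre, him, Lp.coeFn_zero ℂ 2 (stdGaussian E)] with x h3 h4 h5
  rw [h5]
  exact Complex.ext h3 h4

/-- A function orthogonal to all polynomials is orthogonal to their limits, the exponentials, so its
Fourier transform vanishes. -/
theorem topologicalClosure_iSup_polyLE : (⨆ n, polyLE E n).topologicalClosure = ⊤ := by
  rw [Submodule.topologicalClosure_eq_top_iff, Submodule.eq_bot_iff]
  intro f hf
  rw [← Submodule.orthogonal_closure] at hf
  exact eq_zero_of_forall_inner_expL2_eq_zero fun F =>
    (Submodule.mem_orthogonal _ _).1 hf _ (expL2_mem_closure_iSup_polyLE F)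

/-- Each y of degree at most k + 1 splits as its projection y₁ to degree k plus y - y₁ in the chaos
of order k + 1; orthogonality is checked on both pieces. -/
theorem sum_chaosProj (k : ℕ) (f : GaussL2 E) :
    ∑ n ∈ Finset.range (k + 1), chaosProj E n f = (polyLE E k).starProjection f := by
  induction k with
  | zero => simp [chaosProj, chaos]
  | succ k ih =>
    rw [Finset.sum_range_succ, ih, eq_comm]
    set P := (polyLE E k).starProjection f with hP
    set c := chaosProj E (k + 1) f with hc
    have hPm : P ∈ polyLE E k := Submodule.starProjection_apply_mem _ _
    have hcm : c ∈ chaos E (k + 1) := chaosProj_mem _ _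
    refine Submodule.eq_starProjection_of_mem_orthogonal
      (Submodule.add_mem _ (polyLE_mono k.le_succ hPm) hcm.1)
      ((Submodule.mem_orthogonal _ _).2 fun y hy => ?_)
    set y₁ := (polyLE E k).starProjection y with hy₁
    have hy₁m : y₁ ∈ polyLE E k := Submodule.starProjection_apply_mem _ _
    have hy₂m : y - y₁ ∈ chaos E (k + 1) :=
      ⟨Submodule.sub_mem _ hy (polyLE_mono k.le_succ hy₁m),
        Submodule.sub_starProjection_mem_orthogonal _⟩
    have e1 : inner ℂ y₁ (f - P) = 0 := (Submodule.mem_orthogonal _ _).1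
      (Submodule.sub_starProjection_mem_orthogonal _) _ hy₁m
    have e2 : inner ℂ y₁ c = 0 := (Submodule.mem_orthogonal _ _).1 hcm.2 _ hy₁m
    have e3 : inner ℂ (y - y₁) (f - c) = 0 := (Submodule.mem_orthogonal _ _).1
      (Submodule.sub_starProjection_mem_orthogonal _) _ hy₂m
    have e4 : inner ℂ (y - y₁) P = 0 := (Submodule.mem_orthogonal' _ _).1 hy₂m.2 _ hPm
    simp only [inner_sub_left, inner_sub_right, inner_add_right] at *
    linear_combination e1 - e2 + e3 - e4

theorem tendsto_sum_chaosProj (f : GaussL2 E) :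
    Filter.Tendsto (fun k => ∑ n ∈ Finset.range (k + 1), chaosProj E n f) Filter.atTop (nhds f) := by
  simp_rw [sum_chaosProj]
  exact Submodule.starProjection_tendsto_self _ polyLE_mono f topologicalClosure_iSup_polyLE.ge

theorem weightedL1_antitone {ε ε' : ℝ} (h : ε ≤ ε') (f : GaussL2 E) :
    weightedL1 ε' f ≤ weightedL1 ε f := by
  unfold weightedL1
  gcongr with x
  exact gaussWeight_antitone (by linarith) x

theorem norm_chaosProj_le_seminorm (q n : ℕ) (φ : HidaTest E) :
    ‖chaosProj E n (HidaTest.toL2 E φ)‖ ≤ (2 ^ (q * n))⁻¹ * HidaTest.seminorm E q φ := by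
  have h := lp.norm_apply_le_norm (by norm_num) (HidaTest.toEll2 E q φ) n
  change ‖((2 : ℂ) ^ (q * n)) • chaosProj E n (HidaTest.toL2 E φ)‖ ≤ HidaTest.seminorm E q φ at h
  rw [norm_smul, norm_pow, Complex.norm_ofNat] at h
  rw [inv_mul_eq_div, le_div_iff₀ (by positivity), mul_comm]
  exact h

theorem exists_weightedL1_hidaTest_le {ε : ℝ} (hε : 0 < ε) :
    ∃ q : ℕ, ∃ C : ℝ, 0 ≤ C ∧ ∀ φ : HidaTest E,
      weightedL1 ε (HidaTest.toL2 E φ) ≤ ENNReal.ofReal (C * HidaTest.seminorm E q φ) := by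
  -- The polynomial bound needs ε ≤ 1; lowering ε to `min ε 1` only enlarges the weight.
  obtain ⟨K, B, hK, hB, h⟩ := exists_weightedL1_polyLE_le (E := E) (lt_min hε one_pos)
    (min_le_right ε 1)
  obtain ⟨q, hq⟩ := pow_unbounded_of_one_lt (2 * B) (one_lt_two (α := ℝ))
  refine ⟨q, K * 2, by positivity, fun φ => (weightedL1_antitone (min_le_left ε 1) _).trans ?_⟩
  refine weightedL1_le_of_tendsto (tendsto_sum_chaosProj _) tendsto_const_nhds fun k => ?_
  refine (weightedL1_sum_le _ _).trans ?_
  set S := HidaTest.seminorm E q φ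
  have hS : 0 ≤ S := apply_nonneg _ _
  have h1 : ∀ n, weightedL1 (min ε 1) (chaosProj E n (HidaTest.toL2 E φ))
      ≤ ENNReal.ofReal (K * (1 / 2) ^ n * S) := by
    intro n
    refine (h n _ (chaos_le_polyLE n (chaosProj_mem n _))).trans (ENNReal.ofReal_le_ofReal ?_)
    calc K * B ^ n * ‖chaosProj E n (HidaTest.toL2 E φ)‖
        ≤ K * B ^ n * ((2 ^ (q * n))⁻¹ * S) := by
          gcongr
          exact norm_chaosProj_le_seminorm q n φ
      _ = K * (B / 2 ^ q) ^ n * S := by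
          rw [div_pow, ← pow_mul]
          ring
      _ ≤ K * (1 / 2) ^ n * S := by
          have : B / 2 ^ q ≤ 1 / 2 := by
            rw [div_le_iff₀ (by positivity)]
            linarith
          gcongr
  refine (Finset.sum_le_sum fun n _ => h1 n).trans ?_
  rw [← ENNReal.ofReal_sum_of_nonneg fun n _ => by positivity]
  refine ENNReal.ofReal_le_ofReal ?_
  rw [← Finset.sum_mul, ← Finset.mul_sum]
  gcongr
  exact sum_geometric_two_le _

/-- A function dominated by `exp ((1 - ε) ‖x‖² / 2)` with `ε > 0` is a Hida distribution. -/
theorem exists_hidaDistribution_isGivenBy {ε : ℝ} (hε : 0 < ε) {Φ : E → ℂ} {c : ℝ}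
    (hΦ : Continuous Φ) (h : ∀ x, ‖Φ x‖ ≤ c * gaussWeight (ε - 1) x) :
    ∃ Ψ : HidaDistribution E, Ψ.IsGivenBy Φ := by
  have hc : 0 ≤ c := by
    have := (norm_nonneg _).trans (h 0)
    exact nonneg_of_mul_nonneg_left this (gaussWeight_pos _ _)
  obtain ⟨q, C, hC, hq⟩ := exists_weightedL1_hidaTest_le (E := E) hε
  have hle : ∀ φ : HidaTest E, ∫⁻ x, ‖Φ x * HidaTest.toL2 E φ x‖ₑ ∂(stdGaussian E)
      ≤ ENNReal.ofReal (c * (C * HidaTest.seminorm E q φ)) := by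
    intro φ
    rw [ENNReal.ofReal_mul hc]
    refine le_trans ?_ (mul_le_mul_right (hq φ) _)
    rw [weightedL1, ← lintegral_const_mul' _ _ ENNReal.ofReal_ne_top]
    refine lintegral_mono fun x => ?_
    rw [enorm_mul, mul_comm, mul_left_comm, ← ENNReal.ofReal_mul hc]
    gcongr
    rw [← ofReal_norm]
    exact ENNReal.ofReal_le_ofReal (h x)
  have hint : ∀ φ : HidaTest E,
      Integrable (fun x => Φ x * HidaTest.toL2 E φ x) (stdGaussian E) := fun φ =>
    ⟨hΦ.aestronglyMeasurable.mul (Lp.aestronglyMeasurable _),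
      (hle φ).trans_lt ENNReal.ofReal_lt_top⟩
  let L : HidaTest E →ₗ[ℂ] ℂ :=
    { toFun := fun φ => ∫ x, Φ x * HidaTest.toL2 E φ x ∂(stdGaussian E)
      map_add' := fun φ ψ => by
        rw [← integral_add (hint φ) (hint ψ), map_add]
        refine integral_congr_ae
          ((Lp.coeFn_add (HidaTest.toL2 E φ) (HidaTest.toL2 E ψ)).mono fun x hx => ?_)
        simp only
        rw [hx, Pi.add_apply, mul_add]
      map_smul' := fun a φ => by
        rw [RingHom.id_apply, smul_eq_mul, ← integral_const_mul, map_smul]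
        refine integral_congr_ae ((Lp.coeFn_smul a (HidaTest.toL2 E φ)).mono fun x hx => ?_)
        simp only
        rw [hx, Pi.smul_apply, smul_eq_mul]
        ring }
  have hL : ∀ φ, ‖L φ‖ ≤ c * C * HidaTest.seminorm E q φ := by
    intro φ
    have h1 := (enorm_integral_le_lintegral_enorm _).trans (hle φ)
    rw [← ofReal_norm, ENNReal.ofReal_le_ofReal_iff (by positivity), ← mul_assoc] at h1
    exact h1
  have hws : WithSeminorms (HidaTest.seminorm E) := ⟨rfl⟩
  refine ⟨⟨L, ?_⟩, fun φ => ⟨hint φ, rfl⟩⟩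
  refine WithSeminorms.continuous_normedSpace_rng ℂ hws L ⟨{q}, ⟨c * C, by positivity⟩, fun φ => ?_⟩
  rw [Finset.sup_singleton]
  exact hL φ

end Chaos

/-! ### Gaussian integral for a trace-free involution. -/

section GaussianIntegralOfInvolution

variable {E : Type*} [NormedAddCommGroup E] [InnerProductSpace ℝ E] [FiniteDimensional ℝ E]
  [MeasurableSpace E] [BorelSpace E]

/-- The base is 2π(ε + iλ)/(ε² + 1), in the right half-plane, so the cases λ = ±1 have conjugate
principal logarithms. Keeping the phase linear in λ lets it cancel when the λ sum to zero. -/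
theorem cpow_half_pi_div {ε lam : ℝ} (hε : 0 < ε) (hlam : lam ^ 2 = 1) :
    (Real.pi / (((ε : ℂ) - Complex.I * lam) / 2)) ^ (1 / 2 : ℂ)
      = Complex.exp ((1 / 2 : ℂ) * ((Real.log (2 * Real.pi / Real.sqrt (ε ^ 2 + 1)) : ℝ)
          + Complex.I * (Complex.arg (ε + Complex.I)) * lam)) := by
  have he : (0 : ℝ) < ε ^ 2 + 1 := by positivity
  have hec : ((ε : ℂ) ^ 2 + 1) ≠ 0 := by exact_mod_cast he.ne'
  have hr : 0 < 2 * Real.pi / (ε ^ 2 + 1) := by positivity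
  set w : ℂ := ((2 * Real.pi / (ε ^ 2 + 1) : ℝ) : ℂ) * (ε + Complex.I) with hw
  have hz0 : (ε : ℂ) + Complex.I ≠ 0 := fun h => by
    have := congrArg Complex.im h
    simp at this
  have hw0 : w ≠ 0 := mul_ne_zero (by exact_mod_cast hr.ne') hz0
  have hn : ‖w‖ = 2 * Real.pi / Real.sqrt (ε ^ 2 + 1) := by
    have h1 : ‖(ε : ℂ) + Complex.I‖ = Real.sqrt (ε ^ 2 + 1) := by
      rw [Complex.norm_def, Complex.normSq_apply]
      simp [pow_two]
    rw [hw, norm_mul, Complex.norm_real, Real.norm_of_nonneg hr.le, h1]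
    have h2 : Real.sqrt (ε ^ 2 + 1) ≠ 0 := (Real.sqrt_pos.2 he).ne'
    have h3 := Real.sq_sqrt he.le
    rw [div_mul_eq_mul_div, div_eq_div_iff he.ne' h2, mul_assoc, ← pow_two, h3]
  have ha : w.arg = Complex.arg (ε + Complex.I) := Complex.arg_real_mul _ hr
  have hlog : Complex.log w = (Real.log (2 * Real.pi / Real.sqrt (ε ^ 2 + 1)) : ℝ)
      + Complex.I * (Complex.arg (ε + Complex.I)) := by
    rw [Complex.log, hn, ha, mul_comm Complex.I]
  have hpi : w.arg ≠ Real.pi := by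
    intro h
    rw [Complex.arg_eq_pi_iff] at h
    have h1 : w.re = 2 * Real.pi / (ε ^ 2 + 1) * ε := by
      rw [hw, Complex.re_ofReal_mul]
      simp
    have : 0 < w.re := by
      rw [h1]
      positivity
    linarith [h.1]
  have key : ∀ z : ℂ, z ≠ 0 → z ^ (1 / 2 : ℂ) = Complex.exp ((1 / 2) * Complex.log z) := by
    intro z hz
    rw [Complex.cpow_def_of_ne_zero hz, mul_comm]
  have hd : ∀ s : ℂ, s ^ 2 = 1 → (Real.pi / (((ε : ℂ) - Complex.I * s) / 2))
      = ((2 * Real.pi / (ε ^ 2 + 1) : ℝ) : ℂ) * (ε + Complex.I * s) := by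
    intro s hs
    have h1 : ((ε : ℂ) - Complex.I * s) * (ε + Complex.I * s) = ε ^ 2 + 1 := by
      linear_combination (-s ^ 2) * Complex.I_sq + hs
    have h2 : (ε : ℂ) - Complex.I * s ≠ 0 := fun h => hec (by rw [← h1, h, zero_mul])
    push_cast
    field_simp
    linear_combination -h1
  rcases mul_self_eq_one_iff.1 (show lam * lam = 1 by rwa [← pow_two]) with h | h
  · rw [h, Complex.ofReal_one, hd 1 (one_pow 2), mul_one, ← hw, key w hw0, hlog, mul_one]
  · have hc : ((2 * Real.pi / (ε ^ 2 + 1) : ℝ) : ℂ) * (ε + Complex.I * (-1 : ℂ))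
        = (starRingEnd ℂ) w := by
      rw [hw, map_mul, map_add, Complex.conj_ofReal, Complex.conj_ofReal, Complex.conj_I]
      ring
    rw [h, Complex.ofReal_neg, Complex.ofReal_one, hd (-1) (by norm_num), hc,
      key _ ((map_ne_zero _).2 hw0), Complex.log_conj _ hpi, hlog, map_add, map_mul,
      Complex.conj_ofReal, Complex.conj_ofReal, Complex.conj_I]
    congr 2
    ring

/-- The Gaussian integral of `exp (-(ε ‖x‖² - i ⟨x, T x⟩) / 2 + i ⟨x, y⟩)` for a symmetric
involution `T` of trace zero. -/
theorem integral_cexp_involution {ε : ℝ} (hε : 0 < ε) {T : E →ₗ[ℝ] E} (hT : T.IsSymmetric)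
    (hTT : ∀ x, T (T x) = x) (htr : LinearMap.trace ℝ E T = 0) (y : E) :
    ∫ x : E, Complex.exp (-((ε : ℂ) / 2) * ((‖x‖ ^ 2 : ℝ) : ℂ)
        + Complex.I / 2 * ((inner ℝ x (T x) : ℝ) : ℂ) + Complex.I * ((inner ℝ x y : ℝ) : ℂ))
      = (((2 * Real.pi / Real.sqrt (ε ^ 2 + 1)) ^ (Module.finrank ℝ E / 2 : ℝ) : ℝ) : ℂ)
        * Complex.exp (-((ε : ℂ) * ((‖y‖ ^ 2 : ℝ) : ℂ)
            + Complex.I * ((inner ℝ y (T y) : ℝ) : ℂ)) / (2 * ((ε : ℂ) ^ 2 + 1))) := by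
  set b := hT.eigenvectorBasis rfl with hb
  set lam := hT.eigenvalues rfl with hlam
  have hTb : ∀ v i, b.repr (T v) i = lam i * b.repr v i := fun v i =>
    hT.eigenvectorBasis_apply_self_apply rfl v i
  have hlam2 : ∀ i, lam i ^ 2 = 1 := by
    intro i
    have h1 := hTb (T (b i)) i
    rw [hTT, hTb] at h1
    simp only [OrthonormalBasis.repr_self, PiLp.single_apply, if_true] at h1
    linarith
  have hsum : ∑ i, lam i = 0 := by
    have := hT.re_trace_eq_sum_eigenvalues rfl
    rw [htr, map_zero] at this
    exact this.symm
  have hsumC : ∑ i, (lam i : ℂ) = 0 := by exact_mod_cast hsum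
  have hin : ∀ x z : E, inner ℝ x z = ∑ i, b.repr x i * b.repr z i := by
    intro x z
    rw [← b.repr.inner_map_map x z, PiLp.inner_apply]
    refine Finset.sum_congr rfl fun i _ => ?_
    simp [mul_comm]
  have hns : ∀ x : E, ‖x‖ ^ 2 = ∑ i, b.repr x i ^ 2 := by
    intro x
    rw [← real_inner_self_eq_norm_sq, hin]
    simp_rw [pow_two]
  have hec : ((ε : ℂ) ^ 2 + 1) ≠ 0 := by
    have he : (0 : ℝ) < ε ^ 2 + 1 := by positivity
    exact_mod_cast he.ne'
  rw [← b.measurePreserving_repr_symm.integral_comp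
    b.repr.symm.toHomeomorph.measurableEmbedding,
    ← (PiLp.volume_preserving_toLp _).integral_comp (MeasurableEquiv.toLp 2 _).measurableEmbedding]
  have hint := GaussianFourier.integral_cexp_neg_sum_mul_add
    (b := fun i => ((ε : ℂ) - Complex.I * lam i) / 2) (fun i => by simpa using hε)
    (fun i => Complex.I * (b.repr y i : ℂ))
  have hL : ∀ v : Fin (Module.finrank ℝ E) → ℝ,
      -((ε : ℂ) / 2) * ((‖b.repr.symm (WithLp.toLp 2 v)‖ ^ 2 : ℝ) : ℂ)
        + Complex.I / 2 * ((inner ℝ (b.repr.symm (WithLp.toLp 2 v))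
          (T (b.repr.symm (WithLp.toLp 2 v))) : ℝ) : ℂ)
        + Complex.I * ((inner ℝ (b.repr.symm (WithLp.toLp 2 v)) y : ℝ) : ℂ)
      = -∑ i, ((ε : ℂ) - Complex.I * lam i) / 2 * (v i : ℂ) ^ 2
        + ∑ i, Complex.I * (b.repr y i : ℂ) * v i := by
    intro v
    rw [hns, hin, hin]
    simp_rw [hTb, LinearIsometryEquiv.apply_symm_apply]
    push_cast
    rw [Finset.mul_sum, Finset.mul_sum, Finset.mul_sum, ← Finset.sum_neg_distrib,
      ← Finset.sum_add_distrib, ← Finset.sum_add_distrib, ← Finset.sum_add_distrib]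
    refine Finset.sum_congr rfl fun i _ => ?_
    ring
  simp_rw [hL]
  rw [hint, Finset.prod_mul_distrib, ← Complex.exp_sum]
  congr 1
  -- The phases add up to a multiple of the trace, which is zero; only the moduli remain.
  · rw [Finset.prod_congr rfl fun i _ => cpow_half_pi_div hε (hlam2 i), ← Complex.exp_sum,
      ← Finset.mul_sum, Finset.sum_add_distrib, ← Finset.mul_sum, hsumC,
      Finset.sum_const, Finset.card_univ, Fintype.card_fin, mul_zero, add_zero,
      Real.rpow_def_of_pos (by positivity), Complex.ofReal_exp]
    congr 1
    push_cast
    rw [nsmul_eq_mul]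
    ring
  · congr 1
    rw [hns, hin]
    simp_rw [hTb]
    push_cast
    rw [Finset.mul_sum, Finset.mul_sum, ← Finset.sum_add_distrib, ← Finset.sum_neg_distrib,
      Finset.sum_div]
    refine Finset.sum_congr rfl fun i _ => ?_
    have hs : (lam i : ℂ) ^ 2 = 1 := by exact_mod_cast hlam2 i
    have h1 : ((ε : ℂ) - Complex.I * lam i) * (ε + Complex.I * lam i) = ε ^ 2 + 1 := by
      linear_combination (-(lam i : ℂ) ^ 2) * Complex.I_sq + hs
    have h2 : (ε : ℂ) - Complex.I * lam i ≠ 0 := fun h => hec (by rw [← h1, h, zero_mul])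
    rw [mul_pow, Complex.I_sq, div_eq_div_iff (by
      rw [mul_div_assoc']
      exact div_ne_zero (mul_ne_zero (by norm_num) h2) two_ne_zero) (mul_ne_zero two_ne_zero hec)]
    linear_combination (2 * (b.repr y i : ℂ) ^ 2) * h1

end GaussianIntegralOfInvolution

/-! ### Exponentials of quadratic forms are U-functionals. -/

section QuadraticExponential

variable {E : Type*} [NormedAddCommGroup E] [InnerProductSpace ℝ E]

/-- Along a line the exponent is a polynomial of degree 2 in l, so l may be complex. T is an
isometry, whence Q = |·|² works with C = ‖a‖ + ‖b‖ + 1; the 1 only ensures C > 0. -/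
theorem isUFunctional_cexp_involution [FiniteDimensional ℝ E] [MeasurableSpace E] [BorelSpace E]
    {T : E →ₗ[ℝ] E} (hT : T.IsSymmetric)
    (hTT : ∀ x, T (T x) = x) {k : ℝ} (hk : 0 < k) (a b : ℂ) :
    IsUFunctional fun y : E => (k : ℂ) * Complex.exp (-(a * ((‖y‖ ^ 2 : ℝ) : ℂ)
      + b * ((inner ℝ y (T y) : ℝ) : ℂ))) := by
  refine ⟨fun F G => ⟨fun z => (k : ℂ) * Complex.exp (-(
      (a * ((‖G‖ ^ 2 : ℝ) : ℂ) + b * ((inner ℝ G (T G) : ℝ) : ℂ))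
      + z * (2 * a * ((inner ℝ G F : ℝ) : ℂ) + 2 * b * ((inner ℝ G (T F) : ℝ) : ℂ))
      + z ^ 2 * (a * ((‖F‖ ^ 2 : ℝ) : ℂ) + b * ((inner ℝ F (T F) : ℝ) : ℂ)))),
      by fun_prop, fun l => ?_⟩, k, ‖a‖ + ‖b‖ + 1, hk, by positivity,
    LinearMap.BilinMap.toQuadraticMap (innerₗ E), ?_, fun F =>
    ⟨fun z => (k : ℂ) * Complex.exp (-(z ^ 2 * (a * ((‖F‖ ^ 2 : ℝ) : ℂ)
      + b * ((inner ℝ F (T F) : ℝ) : ℂ)))), by fun_prop, fun l => ?_, fun z => ?_⟩⟩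
  · have h1 : ‖G + l • F‖ ^ 2 = ‖G‖ ^ 2 + 2 * l * inner ℝ G F + l ^ 2 * ‖F‖ ^ 2 := by
      rw [norm_add_sq_real, norm_smul, mul_pow, Real.norm_eq_abs, sq_abs, inner_smul_right]
      ring
    have h2 : inner ℝ (G + l • F) (T (G + l • F))
        = inner ℝ G (T G) + 2 * l * inner ℝ G (T F) + l ^ 2 * inner ℝ F (T F) := by
      have h3 : inner ℝ F (T G) = inner ℝ G (T F) := by rw [← hT, real_inner_comm]
      simp only [map_add, map_smul, inner_add_left, inner_add_right, inner_smul_right,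
        real_inner_smul_left, h3]
      ring
    rw [h1, h2]
    push_cast
    congr 2
    ring
  · change Continuous fun x : E => inner ℝ x x
    fun_prop
  · rw [map_smul, norm_smul, mul_pow, Real.norm_eq_abs, sq_abs, inner_smul_right,
      real_inner_smul_left]
    push_cast
    congr 2
    ring
  · have hTF : ‖T F‖ = ‖F‖ := by
      have : ‖T F‖ ^ 2 = ‖F‖ ^ 2 := by
        rw [← real_inner_self_eq_norm_sq, hT, hTT, real_inner_self_eq_norm_sq]
      exact (sq_eq_sq₀ (norm_nonneg _) (norm_nonneg _)).1 this
    have h1 : |inner ℝ F (T F)| ≤ ‖F‖ ^ 2 := by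
      have := abs_real_inner_le_norm F (T F)
      rwa [hTF, ← pow_two] at this
    rw [norm_mul, Complex.norm_real, Real.norm_of_nonneg hk.le]
    refine mul_le_mul_of_nonneg_left ((Complex.norm_exp_le_exp_norm _).trans ?_) hk.le
    refine Real.exp_le_exp.2 ?_
    rw [LinearMap.BilinMap.toQuadraticMap_apply, innerₗ_apply_apply, real_inner_self_eq_norm_sq,
      norm_neg, norm_mul, norm_pow]
    calc ‖z‖ ^ 2 * ‖a * ((‖F‖ ^ 2 : ℝ) : ℂ) + b * ((inner ℝ F (T F) : ℝ) : ℂ)‖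
        ≤ ‖z‖ ^ 2 * (‖a‖ * ‖F‖ ^ 2 + ‖b‖ * ‖F‖ ^ 2) := by
          gcongr
          refine (norm_add_le _ _).trans ?_
          rw [norm_mul, norm_mul, Complex.norm_real, Complex.norm_real,
            Real.norm_of_nonneg (sq_nonneg ‖F‖), Real.norm_eq_abs]
          gcongr
      _ ≤ (‖a‖ + ‖b‖ + 1) * ‖z‖ ^ 2 * ‖F‖ ^ 2 := by
          nlinarith [mul_nonneg (sq_nonneg ‖z‖) (sq_nonneg ‖F‖)]

end QuadraticExponential

/-! ### Traces and dimension of Hermitian matrices. -/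

namespace HermMat

variable {N : ℕ}

theorem trace_mul_eq_inner (A B : HermMat N) :
    (toMatrix A * toMatrix B).trace = ((inner ℝ A B : ℝ) : ℂ) := by
  rw [inner_def, Matrix.trace_mul_comm]
  have h := Matrix.trace_conjTranspose (toMatrix B * toMatrix A)
  rw [Matrix.conjTranspose_mul, conjTranspose_toMatrix, conjTranspose_toMatrix,
    Matrix.trace_mul_comm] at h
  obtain ⟨r, hr⟩ := Complex.conj_eq_iff_real.1 h.symm
  rw [hr, Complex.ofReal_re]

/-- Splitting into real and imaginary parts identifies all complex matrices, of real dimension 2N²,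
with two copies of the Hermitian ones. -/
theorem finrank_eq (N : ℕ) : Module.finrank ℝ (HermMat N) = N ^ 2 := by
  let M := Matrix (Fin N) (Fin N) ℂ
  let L : M →ₗ[ℝ] selfAdjoint M × selfAdjoint M := realPart.prod imaginaryPart
  have hL : Function.Bijective L := by
    constructor
    · intro x y h
      have h1 : realPart x = realPart y := congrArg Prod.fst h
      have h2 : imaginaryPart x = imaginaryPart y := congrArg Prod.snd h
      rw [← realPart_add_I_smul_imaginaryPart x, ← realPart_add_I_smul_imaginaryPart y, h1, h2]
    · rintro ⟨a, b⟩
      refine ⟨(a : M) + Complex.I • (b : M), Prod.ext ?_ ?_⟩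
      · change realPart ((a : M) + Complex.I • (b : M)) = a
        simp
      · change imaginaryPart ((a : M) + Complex.I • (b : M)) = b
        simp
  have h1 := (LinearEquiv.ofBijective L hL).finrank_eq
  have h2 : Module.finrank ℝ M = N * N * 2 := by
    rw [Module.finrank_matrix, Fintype.card_fin, Complex.finrank_real_complex]
  have h3 : Module.finrank ℝ (HermMat N) = Module.finrank ℝ (selfAdjoint M) := rfl
  have h4 : FiniteDimensional ℝ (selfAdjoint M) :=
    inferInstanceAs (FiniteDimensional ℝ (HermMat N))
  rw [Module.finrank_prod, h2] at h1
  rw [h3, pow_two]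
  omega

end HermMat

/-! ### The exchange operator on phase space. -/

namespace PhaseSpace

variable {N d : ℕ}

theorem finrank_eq (N d : ℕ) : Module.finrank ℝ (PhaseSpace N d) = 2 * (d * N ^ 2) := by
  rw [(WithLp.linearEquiv 2 ℝ (Fin d ⊕ Fin d → HermMat N)).finrank_eq,
    Module.finrank_pi_fintype]
  simp only [HermMat.finrank_eq, Finset.sum_const, Finset.card_univ, Fintype.card_sum,
    Fintype.card_fin, smul_eq_mul]
  ring

/-- The exchange `(A, B) ↦ (B, A)`. -/
def exchange (N d : ℕ) : PhaseSpace N d →ₗ[ℝ] PhaseSpace N d where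
  toFun x := WithLp.toLp 2 fun k => x k.swap
  map_add' _ _ := rfl
  map_smul' _ _ := rfl

/-- The reflection `(A, B) ↦ (A, -B)`. -/
def reflect (N d : ℕ) : PhaseSpace N d →ₗ[ℝ] PhaseSpace N d where
  toFun x := WithLp.toLp 2 (Sum.elim (fun μ => x (.inl μ)) fun μ => -x (.inr μ))
  map_add' x y := by
    ext k
    cases k <;> simp [add_comm]
  map_smul' c x := by
    ext k
    cases k <;> simp

@[simp]
theorem exchange_apply (x : PhaseSpace N d) (k : Fin d ⊕ Fin d) : exchange N d x k = x k.swap := rfl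

@[simp]
theorem reflect_inl (x : PhaseSpace N d) (μ : Fin d) : reflect N d x (.inl μ) = x (.inl μ) := rfl

@[simp]
theorem reflect_inr (x : PhaseSpace N d) (μ : Fin d) : reflect N d x (.inr μ) = -x (.inr μ) := rfl

theorem exchange_exchange (x : PhaseSpace N d) : exchange N d (exchange N d x) = x := by
  ext k
  simp

theorem isSymmetric_exchange : (exchange N d).IsSymmetric := by
  intro x y
  simp only [PiLp.inner_apply, Fintype.sum_sum_type, exchange_apply, Sum.swap_inl, Sum.swap_inr]
  exact add_comm _ _

/-- Conjugation by the involution `reflect` turns the exchange into its negative. -/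
theorem trace_exchange : LinearMap.trace ℝ (PhaseSpace N d) (exchange N d) = 0 := by
  have h1 : reflect N d * reflect N d = 1 := by
    ext x k
    cases k <;> simp
  have h2 : reflect N d * exchange N d = -(exchange N d * reflect N d) := by
    ext x k
    cases k <;> simp
  have h3 : LinearMap.trace ℝ _ (exchange N d) = -LinearMap.trace ℝ _ (exchange N d) := by
    calc LinearMap.trace ℝ _ (exchange N d)
        = LinearMap.trace ℝ _ (reflect N d * (reflect N d * exchange N d)) := by
          rw [← mul_assoc, h1, one_mul]
      _ = LinearMap.trace ℝ _ (-(reflect N d * (exchange N d * reflect N d))) := by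
          rw [h2, mul_neg]
      _ = -LinearMap.trace ℝ _ (exchange N d) := by
          rw [map_neg, LinearMap.trace_mul_comm, mul_assoc, h1, mul_one]
  linarith

theorem traceForm_toC (x y : PhaseSpace N d) :
    traceForm x.toC y.toC = ((inner ℝ x y : ℝ) : ℂ) := by
  simp only [traceForm, toC, HermMat.trace_mul_eq_inner, PiLp.inner_apply, Complex.ofReal_sum]

theorem traceForm_symplecticK (ε : ℝ) (x : PhaseSpace N d) :
    traceForm x.toC (symplecticK N d ε x.toC)
      = -((1 - ε : ℂ) * ((‖x‖ ^ 2 : ℝ) : ℂ)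
        + Complex.I * ((inner ℝ x (exchange N d x) : ℝ) : ℂ)) := by
  rw [← real_inner_self_eq_norm_sq, ← traceForm_toC, ← traceForm_toC]
  simp only [traceForm, symplecticK, Finset.mul_sum, ← Finset.sum_add_distrib,
    ← Finset.sum_neg_distrib]
  refine Finset.sum_congr rfl fun k _ => ?_
  rw [mul_neg, Matrix.trace_neg, mul_add, Matrix.trace_add, Matrix.mul_smul, Matrix.mul_smul,
    Matrix.trace_smul, Matrix.trace_smul, smul_eq_mul, smul_eq_mul, Complex.ofReal_sub,
    Complex.ofReal_one]
  rfl

theorem sum_trace_mul_self (y : PhaseSpace N d) :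
    ∑ μ : Fin d, (y.toC (.inl μ) * y.toC (.inl μ) + y.toC (.inr μ) * y.toC (.inr μ)).trace
      = ((‖y‖ ^ 2 : ℝ) : ℂ) := by
  rw [← real_inner_self_eq_norm_sq, ← traceForm_toC, traceForm, Fintype.sum_sum_type,
    ← Finset.sum_add_distrib]
  simp only [Matrix.trace_add]

theorem two_mul_sum_trace_mul (y : PhaseSpace N d) :
    2 * ∑ μ : Fin d, (y.toC (.inl μ) * y.toC (.inr μ)).trace
      = ((inner ℝ y (exchange N d y) : ℝ) : ℂ) := by
  rw [← traceForm_toC, traceForm, Fintype.sum_sum_type, two_mul]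
  congr 1
  refine Finset.sum_congr rfl fun μ _ => ?_
  rw [Matrix.trace_mul_comm]
  rfl

end PhaseSpace

/-! ### The Feynman distribution and its T-transform. -/

section Feynman

open PhaseSpace

variable {N d : ℕ}

theorem feynmanPhi_eq (N d : ℕ) (ε : ℝ) (x : PhaseSpace N d) :
    feynmanPhi N d ε x = ((2 ^ (d * N) * Real.pi ^ (d * N ^ 2) : ℝ) : ℂ)
      * Complex.exp ((1 / 2) * ((1 - ε : ℂ) * ((‖x‖ ^ 2 : ℝ) : ℂ)
        + Complex.I * ((inner ℝ x (exchange N d x) : ℝ) : ℂ))) := by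
  rw [feynmanPhi, traceForm_symplecticK]
  push_cast
  congr 2
  ring

theorem feynmanT_eq (N d : ℕ) (ε : ℝ) (y : PhaseSpace N d) :
    feynmanT N d ε y
      = ((2 ^ (d * N) * (Real.pi / Real.sqrt (ε ^ 2 + 1)) ^ (d * N ^ 2) : ℝ) : ℂ)
        * Complex.exp (-((ε : ℂ) * ((‖y‖ ^ 2 : ℝ) : ℂ)
          + Complex.I * ((inner ℝ y (exchange N d y) : ℝ) : ℂ)) / (2 * ((ε : ℂ) ^ 2 + 1))) := by
  rw [feynmanT, sum_trace_mul_self, ← two_mul_sum_trace_mul]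
  push_cast
  congr 3
  ring

theorem norm_feynmanPhi (ε : ℝ) (x : PhaseSpace N d) :
    ‖feynmanPhi N d ε x‖ = 2 ^ (d * N) * Real.pi ^ (d * N ^ 2) * gaussWeight (ε - 1) x := by
  rw [feynmanPhi_eq, norm_mul, Complex.norm_real, Real.norm_of_nonneg (by positivity),
    Complex.norm_exp, gaussWeight]
  congr 2
  have : (1 / 2) * ((1 - ε : ℂ) * ((‖x‖ ^ 2 : ℝ) : ℂ)
        + Complex.I * ((inner ℝ x (exchange N d x) : ℝ) : ℂ))
      = ((-((ε - 1) / 2) * ‖x‖ ^ 2 : ℝ) : ℂ)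
        + ((inner ℝ x (exchange N d x) / 2 : ℝ) : ℂ) * Complex.I := by
    push_cast
    ring
  rw [this]
  simp only [Complex.add_re, Complex.ofReal_re, Complex.re_ofReal_mul, Complex.I_re, mul_zero,
    add_zero]

theorem continuous_feynmanPhi (N d : ℕ) (ε : ℝ) : Continuous (feynmanPhi N d ε) := by
  have h : Continuous (exchange N d) := (exchange N d).continuous_of_finiteDimensional
  simp_rw [funext (feynmanPhi_eq N d ε)]
  fun_prop

theorem integrable_feynmanPhi (N d : ℕ) {ε : ℝ} (hε : 0 < ε) :
    Integrable (feynmanPhi N d ε) (stdGaussian (PhaseSpace N d)) := by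
  refine (integrable_norm_iff (continuous_feynmanPhi N d ε).aestronglyMeasurable).1 ?_
  simp_rw [norm_feynmanPhi]
  exact (integrable_gaussWeight_stdGaussian (by linarith)).const_mul _

/-- Against Lebesgue measure |Φ|² has density a constant times exp((1 - 2ε)|x|²/2), bounded below by
a positive constant, and a nontrivial phase space has infinite volume. -/
theorem not_memLp_feynmanPhi (hN : 0 < N) (hd : 0 < d) {ε : ℝ} (hε : ε ≤ 1 / 2) :
    ¬ MemLp (feynmanPhi N d ε) 2 (stdGaussian (PhaseSpace N d)) := by
  rw [memLp_two_iff_integrable_sq_norm (continuous_feynmanPhi N d ε).aestronglyMeasurable,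
    integrable_stdGaussian_iff]
  intro h
  set c : ℝ := 2 ^ (d * N) * Real.pi ^ (d * N ^ 2)
  have hc : 0 < c := by positivity
  have hg := gaussConst_pos (PhaseSpace N d)
  have : Nontrivial (PhaseSpace N d) := by
    refine Module.nontrivial_of_finrank_pos (R := ℝ) ?_
    rw [PhaseSpace.finrank_eq]
    positivity
  have : NoncompactSpace (PhaseSpace N d) := NormedSpace.noncompactSpace ℝ _
  have h1 : Integrable (fun _ : PhaseSpace N d => gaussConst (PhaseSpace N d) * c ^ 2) := by
    refine h.mono' aestronglyMeasurable_const (ae_of_all _ fun x => ?_)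
    rw [Real.norm_of_nonneg (by positivity), norm_feynmanPhi, smul_eq_mul, mul_assoc]
    refine mul_le_mul_of_nonneg_left ?_ hg.le
    have h2 : gaussWeight 1 x * gaussWeight (ε - 1) x ^ 2 = gaussWeight (2 * ε - 1) x := by
      rw [pow_two, gaussWeight_mul, gaussWeight_mul]
      ring_nf
    have h3 : 1 ≤ gaussWeight (2 * ε - 1) x := by
      refine Real.one_le_exp (mul_nonneg ?_ (sq_nonneg _))
      linarith
    calc c ^ 2 ≤ c ^ 2 * gaussWeight (2 * ε - 1) x := le_mul_of_one_le_right (by positivity) h3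
      _ = gaussWeight 1 x * (c * gaussWeight (ε - 1) x) ^ 2 := by
          rw [← h2]
          ring
  rw [integrable_const_iff] at h1
  rcases h1 with h1 | h1
  · exact (by positivity : gaussConst (PhaseSpace N d) * c ^ 2 ≠ 0) h1
  · exact (measure_lt_top (volume : Measure (PhaseSpace N d)) Set.univ).ne
      (measure_univ_of_isAddLeftInvariant _)

theorem integral_feynmanPhi_mul_cexp (N d : ℕ) {ε : ℝ} (hε : 0 < ε) (y : PhaseSpace N d) :
    ∫ x, feynmanPhi N d ε x * Complex.exp (Complex.I * ((inner ℝ x y : ℝ) : ℂ))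
      ∂(stdGaussian (PhaseSpace N d)) = feynmanT N d ε y := by
  have h1 : ∀ x : PhaseSpace N d, (gaussConst (PhaseSpace N d) * gaussWeight 1 x)
      • (feynmanPhi N d ε x * Complex.exp (Complex.I * ((inner ℝ x y : ℝ) : ℂ)))
      = ((gaussConst (PhaseSpace N d) * (2 ^ (d * N) * Real.pi ^ (d * N ^ 2)) : ℝ) : ℂ)
        * Complex.exp (-((ε : ℂ) / 2) * ((‖x‖ ^ 2 : ℝ) : ℂ)
          + Complex.I / 2 * ((inner ℝ x (exchange N d x) : ℝ) : ℂ)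
          + Complex.I * ((inner ℝ x y : ℝ) : ℂ)) := by
    intro x
    rw [feynmanPhi_eq, Complex.real_smul, gaussWeight, Complex.ofReal_mul, Complex.ofReal_exp,
      Complex.ofReal_mul (gaussConst _)]
    have : -((ε : ℂ) / 2) * ((‖x‖ ^ 2 : ℝ) : ℂ)
          + Complex.I / 2 * ((inner ℝ x (exchange N d x) : ℝ) : ℂ)
          + Complex.I * ((inner ℝ x y : ℝ) : ℂ)
        = ((-(1 / 2) * ‖x‖ ^ 2 : ℝ) : ℂ)
          + (1 / 2) * ((1 - ε : ℂ) * ((‖x‖ ^ 2 : ℝ) : ℂ)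
          + Complex.I * ((inner ℝ x (exchange N d x) : ℝ) : ℂ))
          + Complex.I * ((inner ℝ x y : ℝ) : ℂ) := by
      push_cast
      ring
    rw [this, Complex.exp_add, Complex.exp_add]
    ring
  rw [integral_stdGaussian]
  simp_rw [h1]
  rw [integral_const_mul, integral_cexp_involution hε isSymmetric_exchange exchange_exchange
    trace_exchange, feynmanT_eq, ← mul_assoc, ← Complex.ofReal_mul]
  congr 2
  -- Half the dimension is the integer dN², so (2π)^(-dN²) π^(dN²) (2π/√(ε²+1))^(dN²) collapses to
  -- (π/√(ε²+1))^(dN²).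
  have h2 : (Module.finrank ℝ (PhaseSpace N d) / 2 : ℝ) = ((d * N ^ 2 : ℕ) : ℝ) := by
    rw [PhaseSpace.finrank_eq]
    push_cast
    ring
  rw [gaussConst, h2, Real.rpow_natCast, Real.rpow_natCast, div_pow, div_pow, mul_pow]
  field_simp

theorem isUFunctional_feynmanT (N d : ℕ) (ε : ℝ) : IsUFunctional (feynmanT N d ε) := by
  have hs : 0 < Real.sqrt (ε ^ 2 + 1) := Real.sqrt_pos.2 (by positivity)
  have h := isUFunctional_cexp_involution (isSymmetric_exchange (N := N) (d := d))
    exchange_exchange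
    (k := 2 ^ (d * N) * (Real.pi / Real.sqrt (ε ^ 2 + 1)) ^ (d * N ^ 2)) (by positivity)
    ((ε : ℂ) / (2 * ((ε : ℂ) ^ 2 + 1))) (Complex.I / (2 * ((ε : ℂ) ^ 2 + 1)))
  convert h using 1
  funext y
  rw [feynmanT_eq]
  congr 2
  ring

end Feynman

end

theorem lemma3p3 (N d : ℕ) (hN : 0 < N) (hd : 0 < d) (ε : ℝ) (hε : 0 < ε) :
    Integrable (feynmanPhi N d ε) (stdGaussian (PhaseSpace N d)) ∧
    (ε ≤ 1 / 2 → ¬ MemLp (feynmanPhi N d ε) 2 (stdGaussian (PhaseSpace N d))) ∧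
    ∃ Ψ : HidaDistribution (PhaseSpace N d),
      Ψ.IsGivenBy (feynmanPhi N d ε) ∧
      Ψ.HasTTransform (feynmanT N d ε) ∧
      IsUFunctional (feynmanT N d ε) := by
  obtain ⟨Ψ, hΨ⟩ := exists_hidaDistribution_isGivenBy hε (continuous_feynmanPhi N d ε)
    fun x => (norm_feynmanPhi ε x).le
  refine ⟨integrable_feynmanPhi N d hε, not_memLp_feynmanPhi hN hd, Ψ, hΨ, fun F => ?_,
    isUFunctional_feynmanT N d ε⟩
  have he := coeFn_toL2_expHidaTest F
  refine ⟨expHidaTest F, he, ?_⟩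
  rw [(hΨ _).2, ← integral_feynmanPhi_mul_cexp N d hε F]
  exact integral_congr_ae (he.mono fun x hx => congrArg (feynmanPhi N d ε x * ·) hx)
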